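/- Let $\mathfrak g$ be a finite-dimensional simple complex Lie algebra with adjoint group $G$, and let $e\in\mathfrak g$ be a minimal nilpotent element, i.e. a nonzero nilpotent element whose $G$-orbit is minimal (with respect to inclusion of closures) among the nonzero nilpotent orbits. Let $(e,h,f)$ be an $\mathfrak{sl}_2$-triple containing $e$, let $\mathfrak g(i)=\{x\in\mathfrak g : [h,x]=ix\}$ (so that $\mathfrak g=\mathfrak g(-2)\oplus\dots\oplus\mathfrak g(2)$ and $\mathfrak g(2)=\mathbb C e$), put $\mathfrak p(e)=\mathfrak g(0)\oplus\mathfrak g(1)\oplus\mathfrak g(2)$ and $\mathfrak g(0)_e=\{x\in\mathfrak g(0) : [x,e]=0\}$. Let $\mathfrak p\subset\mathfrak p(e)$ be a parabolic subalgebra of $\mathfrak g$, and let $P\subset G$ be the corresponding parabolic subgroup. For an algebraic subalgebra $\mathfrak q\subset\mathfrak g$, the Lie algebra of a connected algebraic subgroup $Q\subset G$ with centre $Z$, and $\gamma\in\mathfrak q^*$, let $\mathfrak q_\gamma=\{x\in\mathfrak q : \gamma([x,\mathfrak q])=0\}$ be the Lie algebra of the stabiliser $Q_\gamma$. The form $\gamma$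 is of reductive type if $Q_\gamma/Z$ is a reductive subgroup of $GL(\mathfrak q)$; equivalently, the image of $\mathfrak q_\gamma$ in $\mathfrak{gl}(\mathfrak q)$ is a reductive Lie algebra whose centre consists of semisimple endomorphisms. The form $\gamma$ is of nilpotent type if $\gamma(\mathfrak q_\gamma)=0$. The algebra $\mathfrak q$ is strongly quasi-reductive if it has a form of reductive type and its centre consists of semisimple elements of $\mathfrak g$. In that case $M_*(\mathfrak q)$ denotes any of the subalgebras $\mathfrak q_\gamma$ with $\gamma$ of both reductive and nilpotent type (the Lie algebras of the maximal reductive stabilisers; they are conjugate under $Q$); if $\mathfrak q$ is not strongly quasi-reductive, $M_*(\mathfrak q)=\varnothing$. Then $M_*(\mathfrak p)=M_*(\mathfrak g(0)_e\cap\mathfrak p)$, in the following sense: 1. $\mathfrak p$ is strongly quasi-reductive if and only if $\mathfrak g(0)_e\cap\mathfrak p$ is; 2. a subalgebra $\mathfrak r\subset\mathfrak g$ is a representative of $M_*(\mathfrak p)$ if and only if it is conjugate under $P$ to a representative of $M_*(\mathfrak g(0)_e\cap\mathfrak p)$; 3. every representative of $M_*(\mathfrak p)$ is conjugate under $P$ to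 a representative of $M_*(\mathfrak p)$ that is contained in $\mathfrak g(0)_e\cap\mathfrak p$. -/

import Mathlib

namespace HighestRootReduction

attribute [local instance 100] LieRing.ofAssociativeRing

variable {L : Type*} [LieRing L] [LieAlgebra ℂ L]

/-- The centraliser of an element `x`, as a Lie subalgebra. For the element `h` of an
`sl₂`-triple it is the component of degree `0` of the `h`-grading. -/
def elemCentralizer (x : L) : LieSubalgebra ℂ L where
  carrier := {y | ⁅x, y⁆ = 0}
  zero_mem' := by simp
  add_mem' := by
    intro a b ha hb
    simp only [Set.mem_ofPred_eq] at ha hb ⊢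
    rw [lie_add, ha, hb, add_zero]
  smul_mem' := by
    intro c a ha
    simp only [Set.mem_ofPred_eq] at ha ⊢
    rw [lie_smul, ha, smul_zero]
  lie_mem' := by
    intro a b ha hb
    change ⁅x, a⁆ = 0 at ha
    change ⁅x, b⁆ = 0 at hb
    change ⁅x, ⁅a, b⁆⁆ = 0
    rw [leibniz_lie, ha, hb, zero_lie, lie_zero, add_zero]

/-- The component of degree `i` of the `h`-grading: the eigenspace of `ad h` for `i`. -/
def gradedPiece (h : L) (i : ℤ) : Submodule ℂ L :=
  Module.End.eigenspace (LieAlgebra.ad ℂ L h) (i : ℂ)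

/-! ### Borel and parabolic subalgebras -/

/-- A Borel subalgebra is a maximal solvable subalgebra. -/
def IsBorel (b : LieSubalgebra ℂ L) : Prop :=
  Maximal (fun s : LieSubalgebra ℂ L => LieAlgebra.IsSolvable s) b

/-- A parabolic subalgebra is a subalgebra that contains a Borel subalgebra. -/
def IsParabolic (p : LieSubalgebra ℂ L) : Prop :=
  ∃ b : LieSubalgebra ℂ L, IsBorel b ∧ b ≤ p

/-! ### The adjoint group -/

/-- `φ` is the exponential of the nilpotent derivation `ad x`, for some `x` with `ad x` nilpotent. -/
def IsExpAd (φ : L ≃ₗ⁅ℂ⁆ L) : Prop :=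
  ∃ (x : L) (n : ℕ), (LieAlgebra.ad ℂ L x) ^ n = 0 ∧
    ∀ y, φ y = ∑ k ∈ Finset.range n,
      ((Nat.factorial k : ℂ)⁻¹) • ((LieAlgebra.ad ℂ L x) ^ k) y

/-- Membership in the adjoint group of a semisimple complex Lie algebra (the identity component of
its automorphism group): the group generated by the exponentials `exp (ad x)` with `ad x`
nilpotent. -/
inductive InAdjointGroup : (L ≃ₗ⁅ℂ⁆ L) → Prop
  | exp (φ : L ≃ₗ⁅ℂ⁆ L) : IsExpAd φ → InAdjointGroup φ
  | refl : InAdjointGroup LieEquiv.refl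
  | symm (φ : L ≃ₗ⁅ℂ⁆ L) : InAdjointGroup φ → InAdjointGroup φ.symm
  | trans (φ ψ : L ≃ₗ⁅ℂ⁆ L) : InAdjointGroup φ → InAdjointGroup ψ → InAdjointGroup (φ.trans ψ)

/-- `φ` lies in the parabolic subgroup with Lie algebra `p`: as parabolic subgroups are connected
and self-normalising, it is the stabiliser of `p` in the adjoint group. -/
def InParabolicSubgroup (p : LieSubalgebra ℂ L) (φ : L ≃ₗ⁅ℂ⁆ L) : Prop :=
  InAdjointGroup φ ∧ p.map φ.toLieHom = p

/-! ### Minimal nilpotent elements -/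

/-- `x` is nilpotent (for semisimple `L`): `ad x` is nilpotent. -/
def IsNilpotentElem (x : L) : Prop := IsNilpotent (LieAlgebra.ad ℂ L x)

/-- `x` is semisimple (for semisimple `L`): `ad x` is semisimple. -/
def IsSemisimpleElem (x : L) : Prop := (LieAlgebra.ad ℂ L x).IsSemisimple

/-- The orbit of `x` under the adjoint group. -/
def adjointOrbit (x : L) : Set L := {y | ∃ φ : L ≃ₗ⁅ℂ⁆ L, InAdjointGroup φ ∧ φ x = y}

/-- The Zariski closure of a subset of a complex vector space `V`; the polynomial functions on
`V` are the polynomials in the linear functions. -/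
def zariskiClosure {V : Type*} [AddCommGroup V] [Module ℂ V] (S : Set V) : Set V :=
  {v | ∀ F : MvPolynomial (Module.Dual ℂ V) ℂ,
    (∀ s ∈ S, MvPolynomial.eval (fun l => l s) F = 0) →
      MvPolynomial.eval (fun l => l v) F = 0}

/-- `e` is a minimal nilpotent element: a nonzero nilpotent element whose orbit is minimal, with
respect to inclusion of closures, among the nonzero nilpotent orbits. -/
def IsMinimalNilpotent (e : L) : Prop :=
  e ≠ 0 ∧ IsNilpotentElem e ∧
    ∀ x : L, x ≠ 0 → IsNilpotentElem x →
      x ∈ zariskiClosure (adjointOrbit e) → x ∈ adjointOrbit e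

/-! ### Maximal reductive stabilisers -/

/-- The stabiliser `q_γ` of a linear form `γ` on a Lie algebra `q` for the coadjoint action. -/
def coadjointStabilizer {q : Type*} [LieRing q] [LieAlgebra ℂ q] (γ : Module.Dual ℂ q) :
    LieSubalgebra ℂ q where
  carrier := {x | ∀ y, γ ⁅x, y⁆ = 0}
  zero_mem' := by simp
  add_mem' := by
    intro a b ha hb y
    rw [add_lie, map_add, ha y, hb y, add_zero]
  smul_mem' := by
    intro c a ha y
    rw [smul_lie, map_smul, ha y, smul_zero]
  lie_mem' := by
    intro a b ha hb y
    have ha' : ∀ z, γ ⁅a, z⁆ = 0 := ha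
    have hb' : ∀ z, γ ⁅b, z⁆ = 0 := hb
    rw [lie_lie, map_sub, ha', hb', sub_zero]

/-- A linear Lie algebra `s ⊆ gl(V)` is reductive in the sense of algebraic groups (for algebraic
`s` in characteristic zero: it is the Lie algebra of a reductive subgroup of `GL(V)`): it is a
reductive Lie algebra, and its centre consists of semisimple endomorphisms. -/
def IsReductiveLinear {V : Type*} [AddCommGroup V] [Module ℂ V]
    (s : LieSubalgebra ℂ (Module.End ℂ V)) : Prop :=
  LieAlgebra.HasCentralRadical ℂ s ∧
    ∀ x : s, x ∈ LieAlgebra.center ℂ s → (x : Module.End ℂ V).IsSemisimple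

/-- `γ` is of reductive type: the image of `q_γ` in `gl(q)`, which is `q_γ` modulo the centre of
`q`, is reductive in `gl(q)`. -/
def IsReductiveType {q : Type*} [LieRing q] [LieAlgebra ℂ q] (γ : Module.Dual ℂ q) : Prop :=
  IsReductiveLinear ((coadjointStabilizer γ).map (LieAlgebra.ad ℂ q))

/-- `γ` is of nilpotent type: it vanishes on its own stabiliser. -/
def IsNilpotentType {q : Type*} [LieRing q] [LieAlgebra ℂ q] (γ : Module.Dual ℂ q) : Prop :=
  ∀ x ∈ coadjointStabilizer γ, γ x = 0

/-- A subalgebra `q` of a semisimple Lie algebra `L` is strongly quasi-reductive: it has a linear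
form of reductive type, and its centre consists of semisimple elements. -/
def IsStronglyQuasiReductive (q : LieSubalgebra ℂ L) : Prop :=
  (∃ γ : Module.Dual ℂ q, IsReductiveType γ) ∧
    ∀ x : q, x ∈ LieAlgebra.center ℂ q → IsSemisimpleElem (x : L)

/-- `M_*(q)`, as the set of all its representatives: the Lie algebras `q_γ` (viewed in `L`) of the
maximal reductive stabilisers of `q`, where `γ` is both of reductive and of nilpotent type. It is
empty if `q` is not strongly quasi-reductive. -/
def MStar (q : LieSubalgebra ℂ L) : Set (LieSubalgebra ℂ L) :=
  {r | IsStronglyQuasiReductive q ∧ ∃ γ : Module.Dual ℂ q,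
    IsReductiveType γ ∧ IsNilpotentType γ ∧ r = (coadjointStabilizer γ).map q.incl}

end HighestRootReduction

namespace HighestRootReduction

attribute [local instance 100] LieRing.ofAssociativeRing

variable {L : Type*} [LieRing L] [LieAlgebra ℂ L]

/-! ### Exponentials and the adjoint group -/

/-! Write q for g(0)_e ∩ p. Minimality of e enters only through extremality, [e,[e,x]] ∈ ℂe
(`IsMinimalNilpotent.extremal`): a multiple of a highest root vector is a limit of points in the
orbit of e, hence lies in that orbit. Extremality bounds the weights of ad h by 2 and gives g(2) =
ℂe. A Borel subalgebra inside p contains h, e and g(1), so p = ℂh ⊕ q ⊕ g(1) ⊕ ℂe, and by simplicity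
no nonzero element of g centralises p.

A form of reductive type on p cannot vanish on e (`apply_e_ne_zero`). It is then nondegenerate on
g(1) through the bracket, so exp(ad v) with v ∈ g(1) moves it inside its P-orbit to a form vanishing
on g(1) (`exists_exp_normalizing`). For such a form the stabilisers in p and in q coincide
(`formStabilizer_eq`). Conversely, every form on q extends to one of this shape
(`exists_extension`).

It remains to compare reductivity of one stabiliser acting on p and on q. The action on p is
faithful; the action on q has a kernel in the centre of q, which is controlled by semisimplicity of
that centre and by Jordan decomposition (`reduce`, `lift`). -/

theorem isNilpotent_ad_of_lie_eq_smul [FiniteDimensional ℂ L] {h x : L} {c : ℂ} (hc : c ≠ 0)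
    (hx : ⁅h, x⁆ = c • x) : IsNilpotent (LieAlgebra.ad ℂ L x) := by
  set X := LieAlgebra.ad ℂ L x with hX
  set A := LieAlgebra.ad ℂ L h with hA
  have h1 : A * X - X * A = c • X := by
    rw [← LieRing.of_associative_ring_bracket, hA, hX, ← LieHom.map_lie, hx, map_smul]
  have hk : ∀ k : ℕ, A * X ^ k - X ^ k * A = ((k : ℂ) * c) • X ^ k := by
    intro k
    induction k with
    | zero => simp
    | succ k ih =>
      have : A * X ^ (k + 1) - X ^ (k + 1) * A =
          (A * X ^ k - X ^ k * A) * X + X ^ k * (A * X - X * A) := by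
        rw [pow_succ]; noncomm_ring
      rw [this, ih, h1, smul_mul_assoc, mul_smul_comm, ← pow_succ, ← add_smul]
      congr 1; push_cast; ring
  by_contra hn
  -- Nonzero powers of `X` would be eigenvectors of `ad A` on `End L` for the infinitely many
  -- eigenvalues `k * c`.
  have hne : ∀ k, X ^ k ≠ 0 := fun k hk0 => hn ⟨k, hk0⟩
  have hev : ∀ k : ℕ, Module.End.HasEigenvalue
      (LieAlgebra.ad ℂ (Module.End ℂ L) A) ((k : ℂ) * c) := by
    intro k
    refine Module.End.hasEigenvalue_of_hasEigenvector (x := X ^ k) ⟨?_, hne k⟩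
    rw [Module.End.mem_eigenspace_iff, LieAlgebra.ad_apply, LieRing.of_associative_ring_bracket,
      hk k]
  have hfin : Finite (Module.End.Eigenvalues (LieAlgebra.ad ℂ (Module.End ℂ L) A)) :=
    inferInstance
  let g : ℕ → Module.End.Eigenvalues (LieAlgebra.ad ℂ (Module.End ℂ L) A) :=
    fun k => ⟨(k : ℂ) * c, hev k⟩
  refine not_injective_infinite_finite g fun a b hab => ?_
  have := congrArg Subtype.val hab
  simpa [g, hc] using this

theorem exists_exp_ad [FiniteDimensional ℂ L] {x : L} {n : ℕ}
    (hx : (LieAlgebra.ad ℂ L x) ^ n = 0) :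
    ∃ φ : L ≃ₗ⁅ℂ⁆ L, InAdjointGroup φ ∧ ∀ y, φ y = ∑ k ∈ Finset.range n,
      ((Nat.factorial k : ℂ)⁻¹) • ((LieAlgebra.ad ℂ L x) ^ k) y := by
  -- The exponential of a derivation is formed over ℚ, so scalars are restricted from ℂ.
  let _ : LieAlgebra ℚ L :=
    { (Module.compHom L (algebraMap ℚ ℂ) : Module ℚ L) with
      lie_smul := fun t a b => lie_smul (algebraMap ℚ ℂ t) a b }
  have hsm : ∀ (q : ℚ) (y : L), q • y = (q : ℂ) • y := fun q y => rfl
  have hD : (LieDerivation.ad ℂ L x).toLinearMap = LieAlgebra.ad ℂ L x := by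
    ext y; simp
  have hn : IsNilpotent (LieDerivation.ad ℂ L x).toLinearMap := ⟨n, by rw [hD, hx]⟩
  have key : ∀ y, LieDerivation.exp (LieDerivation.ad ℂ L x) hn y = ∑ k ∈ Finset.range n,
      ((Nat.factorial k : ℂ)⁻¹) • ((LieAlgebra.ad ℂ L x) ^ k) y := by
    intro y
    rw [LieDerivation.exp_map_apply, hD, IsNilpotent.exp_eq_sum hx, LinearMap.sum_apply]
    refine Finset.sum_congr rfl fun k _ => ?_
    rw [LinearMap.smul_apply, hsm]
    push_cast
    rfl
  exact ⟨_, .exp _ ⟨x, n, hx, key⟩, key⟩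

theorem exists_exp_ad_smul [FiniteDimensional ℂ L] {x : L} {n : ℕ}
    (hx : (LieAlgebra.ad ℂ L x) ^ n = 0) (t : ℂ) :
    ∃ φ : L ≃ₗ⁅ℂ⁆ L, InAdjointGroup φ ∧ ∀ y, φ y = ∑ k ∈ Finset.range n,
      t ^ k • ((Nat.factorial k : ℂ)⁻¹) • ((LieAlgebra.ad ℂ L x) ^ k) y := by
  have hx' : (LieAlgebra.ad ℂ L (t • x)) ^ n = 0 := by
    rw [map_smul, smul_pow, hx, smul_zero]
  obtain ⟨φ, h1, h2⟩ := exists_exp_ad hx'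
  refine ⟨φ, h1, fun y => (h2 y).trans (Finset.sum_congr rfl fun k _ => ?_)⟩
  rw [map_smul, smul_pow, LinearMap.smul_apply, smul_comm]

/-- A functional killing `W` but not some coefficient would turn the curve into a nonzero polynomial
in `t` that vanishes everywhere. This differentiates one-parameter groups algebraically. -/
theorem sum_pow_smul_mem {V : Type*} [AddCommGroup V] [Module ℂ V] (W : Submodule ℂ V) {n : ℕ}
    (a : ℕ → V) (h : ∀ t : ℂ, ∑ k ∈ Finset.range n, t ^ k • a k ∈ W) :
    ∀ k < n, a k ∈ W := by
  intro k hk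
  by_contra hc
  obtain ⟨l, hl, hlW⟩ := Submodule.exists_le_ker_of_notMem hc
  let P : Polynomial ℂ := ∑ k ∈ Finset.range n, Polynomial.monomial k (l (a k))
  have hP : P = 0 := by
    refine Polynomial.funext fun t => ?_
    have h1 : l (∑ k ∈ Finset.range n, t ^ k • a k) = 0 := hlW (h t)
    simp only [P, Polynomial.eval_finsetSum, Polynomial.eval_monomial, Polynomial.eval_zero]
    rw [← h1, map_sum]
    refine Finset.sum_congr rfl fun k _ => ?_
    rw [map_smul, smul_eq_mul, mul_comm]
  have : P.coeff k = l (a k) := by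
    simp [P, Polynomial.coeff_monomial, hk]
  rw [hP, Polynomial.coeff_zero] at this
  exact hl this.symm

/-- A subspace stable under the adjoint group is stable under every nilpotent element. -/
theorem lie_mem_of_stable [FiniteDimensional ℂ L] {W : Submodule ℂ L}
    (hW : ∀ φ : L ≃ₗ⁅ℂ⁆ L, InAdjointGroup φ → ∀ w ∈ W, φ w ∈ W) {x : L}
    (hx : IsNilpotentElem x) {w : L} (hw : w ∈ W) : ⁅x, w⁆ ∈ W := by
  obtain ⟨n, hn⟩ := hx
  -- Raising the exponent ensures that the linear coefficient, of index 1, occurs in the sum even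
  -- when `n = 0`.
  have hn' : (LieAlgebra.ad ℂ L x) ^ (n + 2) = 0 := by rw [pow_add, hn, zero_mul]
  have := sum_pow_smul_mem W (n := n + 2)
    (fun k => ((Nat.factorial k : ℂ)⁻¹) • ((LieAlgebra.ad ℂ L x) ^ k) w)
    (fun t => by
      obtain ⟨φ, h1, h2⟩ := exists_exp_ad_smul hn' t
      have := hW φ h1 w hw
      rwa [h2] at this) 1 (by omega)
  simpa using this

/-! ### Existence of a highest root vector -/

section Roots

open LieAlgebra LieModule Module

variable [FiniteDimensional ℂ L] [LieAlgebra.IsSimple ℂ L]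

theorem exists_nonzero_weight (H : LieSubalgebra ℂ L) [H.IsCartanSubalgebra] :
    ∃ α : Weight ℂ H L, α.IsNonZero := by
  by_contra hc
  push Not at hc
  have h1 := LieAlgebra.IsKilling.span_weight_isNonZero_eq_top ℂ L H
  have h2 := (inferInstance : (LieAlgebra.IsKilling.rootSystem H).IsIrreducible)
  have h3 : Nontrivial (Dual ℂ H) := h2.nontrivial
  have h4 : {α : Weight ℂ H L | α.IsNonZero} = ∅ := by
    ext α; simpa using hc α
  rw [h4] at h1
  simp at h1

/-- Order the weights by their values at a point separating them, lexicographically in real and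
imaginary part, and take θ maximal. If γ = 2θ + β, maximality against γ gives β ≤ -θ and maximality
against -β gives the reverse, so γ and θ have the same value. -/
theorem exists_highest_weight (H : LieSubalgebra ℂ L) [H.IsCartanSubalgebra] :
    ∃ θ : Weight ℂ H L, θ.IsNonZero ∧ ∀ β γ : Weight ℂ H L,
      (γ : H → ℂ) = (θ : H → ℂ) + ((θ : H → ℂ) + β) → γ = θ := by
  classical
  let I := {p : Weight ℂ H L × Weight ℂ H L // p.1 ≠ p.2}
  obtain ⟨x, hx⟩ := Module.Dual.exists_forall_ne_zero_of_forall_exists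
    (fun p : I => p.1.1.toLinear - p.1.2.toLinear) (by
      intro p
      by_contra hc
      push Not at hc
      refine p.2 (DFunLike.ext _ _ fun y => ?_)
      have := hc y
      simpa [sub_eq_zero] using this)
  let z : Weight ℂ H L → ℝ ×ₗ ℝ := fun α => toLex ((α x).re, (α x).im)
  have hz : Function.Injective z := by
    intro α β hab
    by_contra hne
    refine hx ⟨(α, β), hne⟩ ?_
    have h1 := congrArg ofLex hab
    simp only [z, ofLex_toLex, Prod.mk.injEq] at h1
    simpa [sub_eq_zero] using Complex.ext h1.1 h1.2
  have hzneg : ∀ α : Weight ℂ H L, z (-α) = - z α := by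
    intro α
    apply ofLex.injective
    simp [z]
  obtain ⟨α₀, hα₀⟩ := exists_nonzero_weight H
  have : Nonempty (Weight ℂ H L) := ⟨α₀⟩
  obtain ⟨θ, hθ⟩ := Finite.exists_max z
  have hsub : ∀ β γ : Weight ℂ H L,
      (γ : H → ℂ) = (θ : H → ℂ) + ((θ : H → ℂ) + β) → γ = θ := by
    intro β γ hγ
    have h1 : z γ = z θ + (z θ + z β) := by
      apply ofLex.injective
      simp [z, hγ]
    have h2 := hθ γ
    have h3 : z β = - z θ := by
      refine le_antisymm ?_ ?_
      · rw [h1] at h2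
        have : z θ + z β ≤ 0 := by simpa using h2
        exact le_neg_iff_add_nonpos_left.mpr this
      · have := hθ (-β)
        rw [hzneg] at this
        exact neg_le.mp this
    apply hz
    rw [h1, h3]; simp
  refine ⟨θ, fun h0 => ?_, hsub⟩
  have hz0 : z θ = 0 := by
    apply ofLex.injective
    have : (θ : H → ℂ) = 0 := h0
    simp [z, this, Prod.ext_iff]
  have h1 : z α₀ = z θ := by
    refine le_antisymm (hθ _) ?_
    have := hθ (-α₀)
    rw [hzneg, hz0] at this
    rw [hz0]; exact neg_nonpos.mp this
  exact hα₀ (hz h1 ▸ h0)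

/-- A highest root vector works: bracketing twice with it sends weight β to 2θ + β, which is a
weight only if it equals θ, and that root space is a line. Nonvanishing is witnessed by `f`, since
[e,[e,f]] = -2e. -/
theorem exists_extremal_elem : ∃ y : L, y ≠ 0 ∧ IsNilpotentElem y ∧
    (∀ x : L, ∃ c : ℂ, ⁅y, ⁅y, x⁆⁆ = c • y) ∧ ∃ x : L, ⁅y, ⁅y, x⁆⁆ ≠ 0 := by
  obtain ⟨x₀, hx₀⟩ := LieAlgebra.exists_isCartanSubalgebra_engel ℂ L
  set H := LieSubalgebra.engel ℂ x₀
  obtain ⟨θ, hθ0, hθ⟩ := exists_highest_weight H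
  obtain ⟨h, e, f, ht, he, hf⟩ := IsKilling.exists_isSl2Triple_of_weight_isNonZero hθ0
  refine ⟨e, ht.e_ne_zero, isNilpotent_ad_of_lie_eq_smul (c := 2) two_ne_zero
    (ht.lie_h_e_smul ℂ), fun x => ?_, f, ?_⟩
  · have h1 := finrank_eq_one_iff'.mp (IsKilling.finrank_rootSpace_eq_one θ hθ0)
    obtain ⟨v, hv0, hv⟩ := h1
    have hspan : ∀ w ∈ rootSpace H θ, w ∈ (ℂ ∙ e : Submodule ℂ L) := by
      intro w hw
      obtain ⟨a, ha⟩ := hv ⟨e, he⟩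
      obtain ⟨b, hb⟩ := hv ⟨w, hw⟩
      have ha' : a • (v : L) = e := congrArg Subtype.val ha
      have hb' : b • (v : L) = w := congrArg Subtype.val hb
      have ha0 : a ≠ 0 := by
        rintro rfl
        exact ht.e_ne_zero (by rw [← ha', zero_smul])
      refine Submodule.mem_span_singleton.mpr ⟨b * a⁻¹, ?_⟩
      rw [← ha', ← hb', smul_smul, mul_assoc, inv_mul_cancel₀ ha0, mul_one]
    have hx : x ∈ (⨆ χ : Weight ℂ H L, genWeightSpace L χ : LieSubmodule ℂ H L) := by
      rw [iSup_genWeightSpace_eq_top' ℂ H L]; trivial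
    suffices ⁅e, ⁅e, x⁆⁆ ∈ (ℂ ∙ e : Submodule ℂ L) by
      obtain ⟨c, hc⟩ := Submodule.mem_span_singleton.mp this
      exact ⟨c, hc.symm⟩
    induction hx using LieSubmodule.iSup_induction' with
    | mem β y hy =>
      by_cases h0 : ⁅e, ⁅e, y⁆⁆ = 0
      · rw [h0]; exact zero_mem _
      have hmem : ⁅e, ⁅e, y⁆⁆ ∈ rootSpace H ((θ : H → ℂ) + ((θ : H → ℂ) + β)) :=
        LieAlgebra.lie_mem_genWeightSpace_of_mem_genWeightSpace he
          (LieAlgebra.lie_mem_genWeightSpace_of_mem_genWeightSpace he hy)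
      let γ : Weight ℂ H L := ⟨(θ : H → ℂ) + ((θ : H → ℂ) + β), fun hb => h0 (by
        have : ⁅e, ⁅e, y⁆⁆ ∈ (⊥ : LieSubmodule ℂ H L) := hb.le hmem
        simpa using this)⟩
      have := hθ β γ rfl
      apply hspan
      rw [← this]
      exact hmem
    | zero => simp
    | add y z _ _ hy hz => rw [lie_add, lie_add]; exact add_mem hy hz
  · rw [ht.lie_e_f, ← lie_skew, ht.lie_h_e_smul ℂ]
    simpa using ht.e_ne_zero

/-- Root vectors are nilpotent, coroots are brackets of root vectors, and the coroots span the
Cartan subalgebra. -/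
theorem nilpotent_lieSpan_eq_top :
    LieSubalgebra.lieSpan ℂ L {x : L | IsNilpotentElem x} = ⊤ := by
  obtain ⟨x₀, hx₀⟩ := LieAlgebra.exists_isCartanSubalgebra_engel ℂ L
  set H := LieSubalgebra.engel ℂ x₀
  set K := LieSubalgebra.lieSpan ℂ L {x : L | IsNilpotentElem x}
  have hroot : ∀ α : Weight ℂ H L, α.IsNonZero → ∀ y ∈ rootSpace H α, y ∈ K := by
    intro α hα y hy
    apply LieSubalgebra.subset_lieSpan
    have hc := IsKilling.root_apply_coroot hα
    have := IsKilling.lie_eq_smul_of_mem_rootSpace hy (IsKilling.coroot α)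
    exact isNilpotent_ad_of_lie_eq_smul (c := 2) two_ne_zero
      (show ⁅((IsKilling.coroot α : H) : L), y⁆ = (2 : ℂ) • y by rw [← hc]; exact this)
  have hco : ∀ α : Weight ℂ H L, α.IsNonZero → ((IsKilling.coroot α : H) : L) ∈ K := by
    intro α hα
    obtain ⟨h, e, f, ht, he, hf⟩ := IsKilling.exists_isSl2Triple_of_weight_isNonZero hα
    rw [← ht.h_eq_coroot hα he hf, ← ht.lie_e_f]
    exact K.lie_mem (hroot α hα e he) (hroot (-α) hα.neg f hf)
  have hH : ∀ y ∈ H, y ∈ K := by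
    intro y hy
    have h1 : (⟨y, hy⟩ : H) ∈ (⊤ : Submodule ℂ H) := trivial
    rw [← RootPairing.IsRootSystem.span_coroot_eq_top (P := IsKilling.rootSystem H)] at h1
    have : Submodule.span ℂ (Set.range (IsKilling.rootSystem H).coroot) ≤
        K.toSubmodule.comap H.toSubmodule.subtype := by
      rw [Submodule.span_le]
      rintro _ ⟨α, rfl⟩
      exact hco α.1 (LieSubalgebra.isNonZero_coe_root α)
    exact this h1
  rw [eq_top_iff]
  rintro x -
  have hx : x ∈ (⨆ χ : Weight ℂ H L, genWeightSpace L χ : LieSubmodule ℂ H L) := by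
    rw [iSup_genWeightSpace_eq_top' ℂ H L]; trivial
  induction hx using LieSubmodule.iSup_induction' with
  | mem β y hy =>
    by_cases hβ : β.IsZero
    · have hβ' : (β : H → ℂ) = 0 := hβ
      rw [hβ'] at hy
      exact hH y (by simpa using hy)
    · exact hroot β hβ y hy
  | zero => exact zero_mem _
  | add y z _ _ hy hz => exact add_mem hy hz

/-- A subspace stable under the adjoint group of a simple Lie algebra is trivial. -/
theorem eq_bot_or_eq_top_of_stable {W : Submodule ℂ L}
    (hW : ∀ φ : L ≃ₗ⁅ℂ⁆ L, InAdjointGroup φ → ∀ w ∈ W, φ w ∈ W) : W = ⊥ ∨ W = ⊤ := by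
  have key : ∀ x : L, ∀ w ∈ W, ⁅x, w⁆ ∈ W := by
    intro x
    have hx : x ∈ LieSubalgebra.lieSpan ℂ L {x : L | IsNilpotentElem x} := by
      rw [nilpotent_lieSpan_eq_top]; trivial
    induction hx using LieSubalgebra.lieSpan_induction with
    | mem x hx => exact fun w hw => lie_mem_of_stable hW hx hw
    | zero => intro w _; rw [zero_lie]; exact zero_mem _
    | add x y _ _ hx hy => intro w hw; rw [add_lie]; exact add_mem (hx w hw) (hy w hw)
    | smul c x _ hx => intro w hw; rw [smul_lie]; exact W.smul_mem _ (hx w hw)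
    | lie x y _ _ hx hy =>
      intro w hw
      rw [lie_lie]
      exact sub_mem (hx _ (hy w hw)) (hy _ (hx w hw))
  let I : LieIdeal ℂ L := { W with lie_mem := fun {x w} hw => key x w hw }
  have hI : I.toSubmodule = W := rfl
  rcases LieAlgebra.IsSimple.eq_bot_or_eq_top (R := ℂ) I with h | h
  · left; rw [← hI, h]; rfl
  · right; rw [← hI, h]; rfl

end Roots

/-! ### Minimal nilpotent elements are extremal -/

theorem exists_exp_ad_quadratic [FiniteDimensional ℂ L] {x : L} (hx : IsNilpotentElem x) (t : ℂ) :
    ∃ φ : L ≃ₗ⁅ℂ⁆ L, InAdjointGroup φ ∧ ∀ y, ⁅x, ⁅x, ⁅x, y⁆⁆⁆ = 0 →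
      φ y = y + t • ⁅x, y⁆ + (t ^ 2 / 2) • ⁅x, ⁅x, y⁆⁆ := by
  obtain ⟨n, hn⟩ := hx
  -- Padding by three splits the series into its quadratic part and a tail that vanishes on the
  -- vectors in question.
  have hn' : (LieAlgebra.ad ℂ L x) ^ (3 + n) = 0 := by rw [pow_add, hn, mul_zero]
  obtain ⟨φ, h1, h2⟩ := exists_exp_ad_smul hn' t
  refine ⟨φ, h1, fun y hy => ?_⟩
  have h3 : ∀ k, ((LieAlgebra.ad ℂ L x) ^ (3 + k)) y = 0 := by
    intro k
    rw [add_comm, pow_add, Module.End.mul_apply]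
    have : ((LieAlgebra.ad ℂ L x) ^ 3) y = 0 := by simpa [pow_succ] using hy
    rw [this, map_zero]
  rw [h2, Finset.sum_range_add]
  simp only [h3, smul_zero, Finset.sum_const_zero, add_zero]
  simp [Finset.sum_range_succ, pow_succ, smul_smul]
  congr 1

/-- A computation inside SL₂: exp((u-1) ad e) exp(ad f) e equals exp(u⁻¹ ad f)(u² e). It makes the
orbit of `e` a cone. -/
theorem exists_map_eq_sq_smul [FiniteDimensional ℂ L] {e h f : L} (ht : IsSl2Triple h e f)
    {u : ℂ} (hu : u ≠ 0) : ∃ φ : L ≃ₗ⁅ℂ⁆ L, InAdjointGroup φ ∧ φ e = u ^ 2 • e := by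
  have hhe : ⁅h, e⁆ = (2 : ℂ) • e := ht.lie_h_e_smul ℂ
  have hhf : ⁅h, f⁆ = (-2 : ℂ) • f := by rw [ht.lie_lie_smul_f ℂ, neg_smul]
  have hef : ⁅e, f⁆ = h := ht.lie_e_f
  have hfe : ⁅f, e⁆ = -h := by rw [← lie_skew, hef]
  have heh : ⁅e, h⁆ = (-2 : ℂ) • e := by rw [← lie_skew, hhe, neg_smul]
  have hfh : ⁅f, h⁆ = (2 : ℂ) • f := by rw [← lie_skew, hhf, neg_smul, neg_neg]
  have hen : IsNilpotentElem e := isNilpotent_ad_of_lie_eq_smul two_ne_zero hhe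
  have hfn : IsNilpotentElem f := isNilpotent_ad_of_lie_eq_smul (neg_ne_zero.mpr two_ne_zero) hhf
  obtain ⟨φ₁, h₁, e₁⟩ := exists_exp_ad_quadratic hfn 1
  obtain ⟨φ₂, h₂, e₂⟩ := exists_exp_ad_quadratic hen (u - 1)
  obtain ⟨φ₃, h₃, e₃⟩ := exists_exp_ad_quadratic hfn u⁻¹
  have v₁ : φ₁ e = e - h - f := by
    rw [e₁ e (by simp [hfe, hfh])]
    simp only [hfe, hfh, lie_neg]; module
  have w₁ : φ₂ e = e := by rw [e₂ e (by simp)]; simp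
  have w₂ : φ₂ h = h - (2 * (u - 1)) • e := by
    rw [e₂ h (by simp [heh])]; simp only [heh, lie_smul, lie_self]; module
  have w₃ : φ₂ f = f + (u - 1) • h - ((u - 1) ^ 2) • e := by
    rw [e₂ f (by simp [hef, heh])]; simp only [hef, heh]; module
  have v₃ : φ₃ e = e - u⁻¹ • h - (u⁻¹ ^ 2) • f := by
    rw [e₃ e (by simp [hfe, hfh])]
    simp only [hfe, hfh, lie_neg]; module
  refine ⟨(φ₁.trans φ₂).trans φ₃.symm, .trans _ _ (.trans _ _ h₁ h₂) (.symm _ h₃), ?_⟩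
  rw [LieEquiv.trans_apply, LieEquiv.trans_apply, v₁, map_sub φ₂, map_sub φ₂, w₁, w₂, w₃]
  have : e - (h - (2 * (u - 1)) • e) - (f + (u - 1) • h - ((u - 1) ^ 2) • e) =
      φ₃ (u ^ 2 • e) := by
    rw [map_smul, v₃, smul_sub, smul_sub, smul_smul, smul_smul]
    have a1 : u ^ 2 * u⁻¹ = u := by field_simp
    have a2 : u ^ 2 * u⁻¹ ^ 2 = 1 := by field_simp
    rw [a1, a2]
    module
  rw [this, LieEquiv.symm_apply_apply]

theorem curve_mem_zariskiClosure {V : Type*} [AddCommGroup V] [Module ℂ V] {S : Set V} (a b c : V)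
    (h : ∀ s : ℂ, s ≠ 0 → s ^ 2 • a + s • b + c ∈ S) : c ∈ zariskiClosure S := by
  intro F hF
  let g : Module.Dual ℂ V → Polynomial ℂ := fun l =>
    Polynomial.C (l a) * Polynomial.X ^ 2 + Polynomial.C (l b) * Polynomial.X + Polynomial.C (l c)
  have hev : ∀ s : ℂ, (MvPolynomial.aeval g F).eval s =
      MvPolynomial.eval (fun l => l (s ^ 2 • a + s • b + c)) F := by
    intro s
    rw [← Polynomial.coe_aeval_eq_eval, ← MvPolynomial.aeval_eq_eval]
    change ((Polynomial.aeval s).comp (MvPolynomial.aeval g)) F = _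
    congr 1
    refine MvPolynomial.algHom_ext fun l => ?_
    simp only [g, AlgHom.comp_apply, MvPolynomial.aeval_X, map_add, map_mul, map_pow,
      Polynomial.aeval_X, Polynomial.aeval_C, map_smul, Algebra.algebraMap_self, RingHom.id_apply,
      smul_eq_mul]
    ring
  -- The factor `X` absorbs the excluded value `s = 0`; cancelling it gives vanishing at the limit
  -- point as well.
  have hP : MvPolynomial.aeval g F * Polynomial.X = 0 := by
    refine Polynomial.funext fun s => ?_
    by_cases hs : s = 0
    · simp [hs]
    · rw [Polynomial.eval_mul, hev, hF _ (h s hs)]; simp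
  have hP' : MvPolynomial.aeval g F = 0 := by
    simpa using hP
  have := hev 0
  rw [hP'] at this
  simpa using this.symm

theorem IsMinimalNilpotent.extremal [FiniteDimensional ℂ L] [LieAlgebra.IsSimple ℂ L]
    {e h f : L} (he : IsMinimalNilpotent e) (ht : IsSl2Triple h e f) (x : L) :
    ∃ c : ℂ, ⁅e, ⁅e, x⁆⁆ = c • e := by
  obtain ⟨y, hy0, hyn, hy, x₀, hx₀⟩ := exists_extremal_elem (L := L)
  have hstab : ∀ z ∈ adjointOrbit e, ∀ φ : L ≃ₗ⁅ℂ⁆ L, InAdjointGroup φ →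
      φ z ∈ adjointOrbit e := by
    rintro _ ⟨ψ, hψ, rfl⟩ φ hφ
    exact ⟨ψ.trans φ, .trans _ _ hψ hφ, rfl⟩
  -- The orbit spans a nonzero stable subspace, hence all of `L`; so (ad y)² cannot kill every point
  -- of the orbit.
  obtain ⟨z, hz, hz0⟩ : ∃ z ∈ adjointOrbit e, ⁅y, ⁅y, z⁆⁆ ≠ 0 := by
    by_contra hc
    push Not at hc
    let W : Submodule ℂ L := Submodule.span ℂ (adjointOrbit e)
    have hW : ∀ φ : L ≃ₗ⁅ℂ⁆ L, InAdjointGroup φ → ∀ w ∈ W, φ w ∈ W := by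
      intro φ hφ w hw
      induction hw using Submodule.span_induction with
      | mem w hw => exact Submodule.subset_span (hstab w hw φ hφ)
      | zero => rw [map_zero]; exact zero_mem _
      | add a b _ _ ha hb => rw [map_add]; exact add_mem ha hb
      | smul c a _ ha => rw [map_smul]; exact W.smul_mem _ ha
    have heW : e ∈ W := Submodule.subset_span ⟨LieEquiv.refl, .refl, rfl⟩
    have htop : W = ⊤ := by
      refine (eq_bot_or_eq_top_of_stable hW).resolve_left fun hb => he.1 ?_
      rw [hb] at heW
      simpa using heW
    have hx : x₀ ∈ W := by rw [htop]; trivial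
    have hle : W ≤ LinearMap.ker ((LieAlgebra.ad ℂ L y) ^ 2) := by
      rw [Submodule.span_le]
      intro w hw
      simpa [pow_succ] using hc w hw
    exact hx₀ (by simpa [pow_succ] using hle hx)
  have hcone : ∀ w ∈ adjointOrbit e, ∀ s : ℂ, s ≠ 0 → s ^ 2 • w ∈ adjointOrbit e := by
    rintro _ ⟨ψ, hψ, rfl⟩ s hs
    obtain ⟨φ, hφ, hφe⟩ := exists_map_eq_sq_smul ht hs
    refine ⟨φ.trans ψ, .trans _ _ hφ hψ, ?_⟩
    rw [LieEquiv.trans_apply, hφe, map_smul]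
  obtain ⟨c, hc⟩ := hy z
  have hc0 : c ≠ 0 := by rintro rfl; exact hz0 (by rw [hc, zero_smul])
  -- The curve s² exp(s⁻¹ ad y) z = s² z + s[y,z] + (c/2)y stays in the conical orbit for s ≠ 0. By
  -- minimality its limit is conjugate to `e`, and extremality of `y` is transported back.
  have hmem : (c / 2) • y ∈ zariskiClosure (adjointOrbit e) := by
    refine curve_mem_zariskiClosure z ⁅y, z⁆ _ fun s hs => ?_
    obtain ⟨φ, hφ, hφz⟩ := exists_exp_ad_quadratic hyn s⁻¹
    have h1 := hcone _ (hstab z hz φ hφ) s hs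
    rw [hφz z (by rw [hc, lie_smul, lie_self, smul_zero]), hc, smul_add, smul_add, smul_smul,
      smul_smul, smul_smul] at h1
    have a1 : s ^ 2 * s⁻¹ = s := by field_simp
    have a2 : s ^ 2 * (s⁻¹ ^ 2 / 2) * c = c / 2 := by field_simp
    rwa [a1, a2] at h1
  have hne : (c / 2) • y ≠ 0 := smul_ne_zero (div_ne_zero hc0 two_ne_zero) hy0
  have hnil : IsNilpotentElem ((c / 2) • y) := by
    unfold IsNilpotentElem
    rw [map_smul]
    exact hyn.smul _
  obtain ⟨φ, hφ, hφe⟩ := he.2.2 _ hne hnil hmem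
  obtain ⟨d, hd⟩ := hy (φ x)
  refine ⟨(c / 2) * d, φ.injective ?_⟩
  change φ _ = φ _
  rw [LieEquiv.map_lie, LieEquiv.map_lie, hφe, map_smul, hφe, smul_lie, smul_lie, lie_smul, hd]
  module

/-! ### The grading defined by an extremal element -/

/-- Normal ordering E³F = 0 gives `s1`. Commuting `s1` with F gives `s2`, and commuting that with F
gives `s3`, H(H-1)(H-2) = 6HFE. Finally F²·`s1`, rewritten by `s2`, shows that (H+2)(H+1) kills HFE.
-/
theorem sl2_polynomial {A : Type*} [Ring A] [Algebra ℂ A] {E F H : A}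
    (hHE : E * H = H * E - 2 • E) (hHF : F * H = H * F + 2 • F) (hEF : E * F = F * E + H)
    (hE : E * E * E = 0) :
    (H + 2) * ((H + 1) * (H * ((H - 1) * (H - 2)))) = 0 := by
  have hHE' : ∀ x, E * (H * x) = H * (E * x) - 2 • (E * x) := fun x => by
    rw [← mul_assoc, hHE, sub_mul, mul_assoc, smul_mul_assoc]
  have hHF' : ∀ x, F * (H * x) = H * (F * x) + 2 • (F * x) := fun x => by
    rw [← mul_assoc, hHF, add_mul, mul_assoc, smul_mul_assoc]
  have hEF' : ∀ x, E * (F * x) = F * (E * x) + H * x := fun x => by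
    rw [← mul_assoc, hEF, add_mul, mul_assoc]
  have hE' : ∀ x, E * (E * (E * x)) = 0 := fun x => by
    rw [← mul_assoc, ← mul_assoc, hE, zero_mul]
  have hE'' : E * (E * E) = 0 := by rw [← mul_assoc, hE]
  have three : ∀ x : A, (3 : ℂ) • x = 0 → x = 0 := fun x hx => by simpa using hx
  have two : ∀ x : A, (2 : ℂ) • x = 0 → x = 0 := fun x hx => by simpa using hx
  have s1 : H * (E * E) = (2 : ℂ) • (E * E) := by
    have h0 : E * (E * (E * F)) = 0 := by
      rw [hE']
    rw [← sub_eq_zero]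
    apply three
    rw [← h0]
    simp only [hEF, hEF', hHE, hHE', mul_add, mul_sub, mul_smul_comm, hE'', mul_zero]
    module
  have s2 : F * (E * E) = H * (H * E) - (3 : ℂ) • (H * E) + (2 : ℂ) • E := by
    have h0 : (H * (E * E) - (2 : ℂ) • (E * E)) * F - F * (H * (E * E) - (2 : ℂ) • (E * E)) = 0 := by
      rw [s1]; simp
    rw [← sub_eq_zero]
    apply two
    rw [← neg_eq_zero, ← h0]
    simp only [mul_assoc, sub_mul, smul_mul_assoc, hEF, hEF', hHE, hHF', mul_add, mul_sub,
      mul_smul_comm]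
    module
  have s3 : H * ((H - 1) * (H - 2)) = (6 : ℂ) • (H * (F * E)) := by
    have h0 : (F * (E * E) - (H * (H * E) - (3 : ℂ) • (H * E) + (2 : ℂ) • E)) * F -
        F * (F * (E * E) - (H * (H * E) - (3 : ℂ) • (H * E) + (2 : ℂ) • E)) = 0 := by
      rw [s2]; simp
    have e2 : (2 : A) = (2 : ℂ) • 1 := by rw [two_smul]; norm_num
    rw [← sub_eq_zero, ← neg_eq_zero, ← h0, e2]
    simp only [mul_assoc, sub_mul, add_mul, smul_mul_assoc, hEF, hEF', hHE, hHF', mul_add,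
      mul_sub, mul_smul_comm, mul_one, one_mul]
    module
  have s4 : H * (H * (H * (F * E))) + (3 : ℂ) • (H * (H * (F * E))) + (2 : ℂ) • (H * (F * E))
      = 0 := by
    have h0 : F * (F * (H * (E * E) - (2 : ℂ) • (E * E))) = 0 := by
      rw [s1]; simp
    rw [← h0]
    simp only [hHF', mul_add, mul_sub, mul_smul_comm, s2]
    module
  have e2 : H + 2 = H + (2 : ℂ) • 1 := by rw [two_smul]; norm_num
  rw [s3, e2, ← (smul_zero (6 : ℂ) : (6 : ℂ) • (0 : A) = 0), ← s4]
  simp only [add_mul, mul_add, mul_smul_comm, smul_mul_assoc, one_mul]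
  module

/-- An `sl₂`-triple whose nilpositive element `e` satisfies `[e, [e, L]] ⊆ ℂ e`. -/
structure IsExtremalTriple (h e f : L) : Prop extends IsSl2Triple h e f where
  extremal : ∀ x : L, ∃ c : ℂ, ⁅e, ⁅e, x⁆⁆ = c • e

theorem lie_weight {h x y : L} {a b : ℂ} (hx : ⁅h, x⁆ = a • x) (hy : ⁅h, y⁆ = b • y) :
    ⁅h, ⁅x, y⁆⁆ = (a + b) • ⁅x, y⁆ := by
  rw [leibniz_lie, hx, hy, smul_lie, lie_smul, add_smul]

namespace IsExtremalTriple

variable {h e f : L} (t : IsExtremalTriple h e f)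
include t

theorem lie_h_e' : ⁅h, e⁆ = (2 : ℂ) • e := t.toIsSl2Triple.lie_h_e_smul ℂ

theorem lie_h_f' : ⁅h, f⁆ = (-2 : ℂ) • f := by
  rw [t.toIsSl2Triple.lie_lie_smul_f ℂ, neg_smul]

theorem lie_e_lie_e_lie_e (x : L) : ⁅e, ⁅e, ⁅e, x⁆⁆⁆ = 0 := by
  obtain ⟨c, hc⟩ := t.extremal x
  rw [hc, lie_smul, lie_self, smul_zero]

theorem ad_h_polynomial (x : L) :
    let H := LieAlgebra.ad ℂ L h
    H (H (H (H (H x)))) - (5 : ℂ) • H (H (H x)) + (4 : ℂ) • H x = 0 := by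
  set E := LieAlgebra.ad ℂ L e with hE
  set F := LieAlgebra.ad ℂ L f with hF
  set H := LieAlgebra.ad ℂ L h with hH
  have h1 : ⁅H, E⁆ = 2 • E := by rw [hH, hE, ← LieHom.map_lie, t.lie_h_e_nsmul, map_nsmul]
  have h2 : ⁅H, F⁆ = -(2 • F) := by
    rw [hH, hF, ← LieHom.map_lie, t.lie_h_f_nsmul, map_neg, map_nsmul]
  have h3 : ⁅E, F⁆ = H := by rw [hE, hF, ← LieHom.map_lie, t.lie_e_f]
  rw [LieRing.of_associative_ring_bracket] at h1 h2 h3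
  have := sl2_polynomial (E := E) (F := F) (H := H) (by rw [← h1]; abel)
    (by rw [← neg_neg (2 • F), ← h2]; abel) (by rw [← h3]; abel)
    (by ext y; simpa [hE] using t.lie_e_lie_e_lie_e y)
  have hx := LinearMap.congr_fun this x
  have h2' : (2 : Module.End ℂ L) = (2 : ℂ) • 1 := by rw [two_smul]; norm_num
  rw [h2'] at hx
  simp only [Module.End.mul_apply, LinearMap.add_apply, LinearMap.sub_apply, LinearMap.smul_apply,
    Module.End.one_apply, map_add, map_sub, map_smul, LinearMap.zero_apply] at hx
  rw [← hx]
  module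

theorem eq_zero_of_weight {x : L} {c : ℂ} (hx : ⁅h, x⁆ = c • x)
    (hc : c * (c ^ 2 - 1) * (c ^ 2 - 4) ≠ 0) : x = 0 := by
  have := t.ad_h_polynomial x
  simp only [LieAlgebra.ad_apply, hx, lie_smul] at this
  have h2 : (c * (c ^ 2 - 1) * (c ^ 2 - 4)) • x = 0 := by
    rw [← this]; module
  exact (smul_eq_zero.mp h2).resolve_left hc

theorem exists_decomposition (x : L) : ∃ a b c d k : L, ⁅h, a⁆ = (-2 : ℂ) • a ∧
    ⁅h, b⁆ = (-1 : ℂ) • b ∧ ⁅h, c⁆ = (0 : ℂ) • c ∧ ⁅h, d⁆ = (1 : ℂ) • d ∧ ⁅h, k⁆ = (2 : ℂ) • k ∧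
    x = a + b + c + d + k := by
  have hp := t.ad_h_polynomial x
  simp only [LieAlgebra.ad_apply] at hp
  set x1 := ⁅h, x⁆
  set x2 := ⁅h, x1⁆ with h2
  set x3 := ⁅h, x2⁆ with h3
  set x4 := ⁅h, x3⁆ with h4
  have h5 : ⁅h, x4⁆ = (5 : ℂ) • x3 - (4 : ℂ) • x1 := by
    rw [← sub_eq_zero, ← hp]; module
  -- Lagrange interpolation projectors for `ad h` at the nodes -2, …, 2; the denominators are the
  -- products of differences of nodes 24, -6, 4, -6, 24.
  refine ⟨(1 / 24 : ℂ) • (x4 - (2 : ℂ) • x3 - x2 + (2 : ℂ) • x1),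
    (-1 / 6 : ℂ) • (x4 - x3 - (4 : ℂ) • x2 + (4 : ℂ) • x1),
    (1 / 4 : ℂ) • (x4 - (5 : ℂ) • x2 + (4 : ℂ) • x),
    (-1 / 6 : ℂ) • (x4 + x3 - (4 : ℂ) • x2 - (4 : ℂ) • x1),
    (1 / 24 : ℂ) • (x4 + (2 : ℂ) • x3 - x2 - (2 : ℂ) • x1), ?_, ?_, ?_, ?_, ?_, ?_⟩ <;>
  first
  | module
  | (simp only [lie_smul, lie_add, lie_sub, h5, ← h2, ← h3, ← h4,
      show ⁅h, x⁆ = x1 from rfl]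
     module)

/-- Extremality applied to [f,[f,x]] suffices, because [e,[e,[f,[f,x]]]] = 4x for a vector of
highest weight 2. -/
theorem exists_smul_e_of_weight {x : L} (hx : ⁅h, x⁆ = (2 : ℂ) • x) : ∃ c : ℂ, x = c • e := by
  have hhf := t.lie_h_f'
  have hfx : ⁅h, ⁅f, x⁆⁆ = (0 : ℂ) • ⁅f, x⁆ := by
    rw [lie_weight hhf hx]; norm_num
  have hex : ⁅e, x⁆ = 0 := t.eq_zero_of_weight (lie_weight t.lie_h_e' hx) (by norm_num)
  have h1 : ⁅e, ⁅f, x⁆⁆ = (2 : ℂ) • x := by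
    rw [leibniz_lie, t.lie_e_f, hex, lie_zero, add_zero, hx]
  have h2 : ⁅e, ⁅f, ⁅f, x⁆⁆⁆ = (2 : ℂ) • ⁅f, x⁆ := by
    rw [leibniz_lie, t.lie_e_f, hfx, h1, lie_smul, zero_smul, zero_add]
  obtain ⟨c, hc⟩ := t.extremal ⁅f, ⁅f, x⁆⁆
  rw [h2, lie_smul, h1, smul_smul] at hc
  refine ⟨c / 4, ?_⟩
  have : x = (1 / 4 : ℂ) • (((2 : ℂ) * 2) • x) := by module
  rw [this, hc]; module

theorem lie_e_eq_zero_of_weight {x : L} (hx : ⁅h, x⁆ = (1 : ℂ) • x) : ⁅e, x⁆ = 0 :=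
  t.eq_zero_of_weight (lie_weight t.lie_h_e' hx) (by norm_num)

theorem exists_lie_eq_smul_e {x y : L} (hx : ⁅h, x⁆ = (1 : ℂ) • x) (hy : ⁅h, y⁆ = (1 : ℂ) • y) :
    ∃ c : ℂ, ⁅x, y⁆ = c • e :=
  t.exists_smul_e_of_weight (by rw [lie_weight hx hy]; norm_num)

/-- The centraliser of the span of `h`, `e` and the vectors of weight one is trivial. -/
theorem eq_zero_of_centralizes [LieAlgebra.IsSimple ℂ L] {x : L} (hxh : ⁅h, x⁆ = 0)
    (hxe : ⁅e, x⁆ = 0) (hx1 : ∀ v : L, ⁅h, v⁆ = (1 : ℂ) • v → ⁅v, x⁆ = 0) : x = 0 := by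
  have hhf := t.lie_h_f'
  -- A highest weight vector of weight 0 spans a trivial `sl₂`-module.
  have hfx : ∀ z : L, ⁅h, z⁆ = 0 → ⁅e, z⁆ = 0 → ⁅f, z⁆ = 0 := by
    intro z hz he
    have w : ⁅h, ⁅f, z⁆⁆ = (-2 : ℂ) • ⁅f, z⁆ := by
      rw [leibniz_lie, hz, lie_zero, add_zero, hhf, smul_lie]
    have w1 : ⁅f, ⁅f, z⁆⁆ = 0 := t.eq_zero_of_weight (lie_weight hhf w) (by norm_num)
    have w2 : ⁅e, ⁅f, z⁆⁆ = 0 := by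
      rw [leibniz_lie, t.lie_e_f, hz, he, lie_zero, add_zero]
    have w3 : ⁅f, ⁅e, ⁅f, z⁆⁆⁆ = (2 : ℂ) • ⁅f, z⁆ := by
      rw [leibniz_lie, ← lie_skew f e, t.lie_e_f, w1, lie_zero, add_zero, neg_lie, w]; module
    rw [w2, lie_zero] at w3
    exact (smul_eq_zero.mp w3.symm).resolve_left two_ne_zero
  -- The negative pieces are g(-1) = [f, g(1)] and g(-2) = [f, g(0)], so their action on the
  -- centraliser `Z` below is determined by `f` and nonnegative degrees. This makes `Z` an ideal,
  -- proper because [h,e] ≠ 0.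
  have hm1 : ∀ v : L, ⁅h, v⁆ = (-1 : ℂ) • v → ∃ w : L, ⁅h, w⁆ = (1 : ℂ) • w ∧ v = ⁅f, w⁆ := by
    intro v hv
    refine ⟨⁅e, v⁆, by rw [lie_weight t.lie_h_e' hv]; norm_num, ?_⟩
    have : ⁅f, v⁆ = 0 := t.eq_zero_of_weight (lie_weight hhf hv) (by norm_num)
    rw [leibniz_lie, this, lie_zero, add_zero, ← lie_skew f e, t.lie_e_f, neg_lie, hv]; module
  have hm2 : ∀ v : L, ⁅h, v⁆ = (-2 : ℂ) • v → ∃ w : L, ⁅h, w⁆ = 0 ∧ v = ⁅f, w⁆ := by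
    intro v hv
    refine ⟨(1 / 2 : ℂ) • ⁅e, v⁆, by rw [lie_smul, lie_weight t.lie_h_e' hv]; norm_num, ?_⟩
    have : ⁅f, v⁆ = 0 := t.eq_zero_of_weight (lie_weight hhf hv) (by norm_num)
    rw [lie_smul, leibniz_lie, this, lie_zero, add_zero, ← lie_skew f e, t.lie_e_f, neg_lie, hv]
    module
  let Z : Submodule ℂ L :=
    { carrier := {z | ⁅h, z⁆ = 0 ∧ ⁅e, z⁆ = 0 ∧ ∀ v : L, ⁅h, v⁆ = (1 : ℂ) • v → ⁅v, z⁆ = 0}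
      zero_mem' := by simp
      add_mem' := by
        rintro a b ⟨a1, a2, a3⟩ ⟨b1, b2, b3⟩
        exact ⟨by rw [lie_add, a1, b1, add_zero], by rw [lie_add, a2, b2, add_zero],
          fun v hv => by rw [lie_add, a3 v hv, b3 v hv, add_zero]⟩
      smul_mem' := by
        rintro c a ⟨a1, a2, a3⟩
        exact ⟨by rw [lie_smul, a1, smul_zero], by rw [lie_smul, a2, smul_zero],
          fun v hv => by rw [lie_smul, a3 v hv, smul_zero]⟩ }
  have hZ0 : ∀ c : L, ⁅h, c⁆ = 0 → ∀ z ∈ Z, ⁅c, z⁆ ∈ Z := by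
    rintro c hc z ⟨z0, z2, z1⟩
    refine ⟨by rw [leibniz_lie, hc, z0]; simp, ?_, fun v hv => ?_⟩
    · obtain ⟨r, hr⟩ := t.exists_smul_e_of_weight (x := ⁅e, c⁆)
        (by rw [leibniz_lie, hc, lie_zero, add_zero, t.lie_h_e', smul_lie])
      rw [leibniz_lie, hr, smul_lie, z2]; simp
    · rw [leibniz_lie, z1 v hv, lie_zero, add_zero]
      refine z1 _ ?_
      rw [leibniz_lie, hc, hv]; simp
  have hZ : ∀ y : L, ∀ z ∈ Z, ⁅y, z⁆ ∈ Z := by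
    intro y z hz
    obtain ⟨z0, z2, z1⟩ := hz
    have zf := hfx z z0 z2
    obtain ⟨a, b, c, d, k, ha, hb, hc, hd, hk, rfl⟩ := t.exists_decomposition y
    rw [zero_smul] at hc
    have ea : ⁅a, z⁆ = 0 := by
      obtain ⟨w, hw, rfl⟩ := hm2 a ha
      obtain ⟨w0, w2, -⟩ := hZ0 w hw z ⟨z0, z2, z1⟩
      rw [lie_lie, zf, hfx _ w0 w2]; simp
    have eb : ⁅b, z⁆ = 0 := by
      obtain ⟨w, hw, rfl⟩ := hm1 b hb
      rw [lie_lie, zf, z1 w hw]; simp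
    have ed : ⁅d, z⁆ = 0 := z1 d hd
    have ek : ⁅k, z⁆ = 0 := by
      obtain ⟨r, rfl⟩ := t.exists_smul_e_of_weight hk
      rw [smul_lie, z2, smul_zero]
    simp only [add_lie, ea, eb, ed, ek, add_zero, zero_add]
    exact hZ0 c hc z ⟨z0, z2, z1⟩
  let I : LieIdeal ℂ L := { Z with lie_mem := fun {y z} hz => hZ y z hz }
  have hI : ∀ z, z ∈ I ↔ z ∈ Z := fun z => Iff.rfl
  have hxI : x ∈ I := ⟨hxh, hxe, hx1⟩
  rcases LieAlgebra.IsSimple.eq_bot_or_eq_top (R := ℂ) I with hbot | htop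
  · rw [hbot] at hxI; simpa using hxI
  · have : e ∈ I := by rw [htop]; trivial
    have := this.1
    rw [t.lie_h_e'] at this
    exact absurd ((smul_eq_zero.mp this).resolve_left two_ne_zero) t.e_ne_zero

omit t in
theorem killingForm_eq_zero_of_weight {x y : L} {a b : ℂ} (hx : ⁅h, x⁆ = a • x)
    (hy : ⁅h, y⁆ = b • y) (hab : a + b ≠ 0) : killingForm ℂ L x y = 0 := by
  have h1 := LieModule.traceForm_apply_lie_apply ℂ L L x h y
  rw [hy, ← lie_skew, hx, map_neg, map_smul, map_smul, LinearMap.neg_apply,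
    LinearMap.smul_apply, smul_eq_mul, smul_eq_mul] at h1
  have h2 : (a + b) * killingForm ℂ L x y = 0 := by
    unfold killingForm; linear_combination -h1
  exact (mul_eq_zero.mp h2).resolve_left hab

/-- The bracket is a nondegenerate form on the vectors of weight one. -/
theorem eq_zero_of_weight_one [FiniteDimensional ℂ L] [LieAlgebra.IsSimple ℂ L] {v : L}
    (hv : ⁅h, v⁆ = (1 : ℂ) • v) (hv' : ∀ w : L, ⁅h, w⁆ = (1 : ℂ) • w → ⁅v, w⁆ = 0) : v = 0 := by
  have hfv : ⁅h, ⁅f, v⁆⁆ = (-1 : ℂ) • ⁅f, v⁆ := by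
    rw [lie_weight t.lie_h_f' hv]; norm_num
  -- For weight reasons [f,v] pairs only with g(1), where invariance gives κ([f,v],d) = κ(f,[v,d]) =
  -- 0. Then v = [e,[f,v]] vanishes too.
  have hk : killingForm ℂ L ⁅f, v⁆ = 0 := by
    ext y
    obtain ⟨a, b, c, d, k, ha, hb, hc, hd, hk, rfl⟩ := t.exists_decomposition y
    have hd' : killingForm ℂ L ⁅f, v⁆ d = 0 := by
      have := LieModule.traceForm_apply_lie_apply ℂ L L f v d
      rw [hv' d hd, map_zero] at this
      exact this
    simp only [map_add, LinearMap.zero_apply, hd',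
      killingForm_eq_zero_of_weight hfv ha (by norm_num),
      killingForm_eq_zero_of_weight hfv hb (by norm_num),
      killingForm_eq_zero_of_weight hfv hc (by norm_num),
      killingForm_eq_zero_of_weight hfv hk (by norm_num), add_zero]
  have h0 : ⁅f, v⁆ = 0 := by
    have : ⁅f, v⁆ ∈ LinearMap.ker (killingForm ℂ L) := hk
    simpa using this
  have h1 : ⁅e, ⁅f, v⁆⁆ = v := by
    rw [leibniz_lie, t.lie_e_f, t.lie_e_eq_zero_of_weight hv, lie_zero, add_zero, hv, one_smul]
  rw [← h1, h0, lie_zero]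

end IsExtremalTriple

/-! ### Jordan decomposition of inner derivations -/

/-- Commutation with x acts on polynomials in y as z·d/dy. Applied repeatedly to the minimal
polynomial p it gives z^k p^(k)(y) = 0, and for k = deg p the derivative is the constant k!. -/
theorem isNilpotent_of_commutator {A : Type*} [Ring A] [Algebra ℂ A] [FiniteDimensional ℂ A]
    {x y z : A} (h : x * y - y * x = z) (hx : Commute x z) (hy : Commute y z) : IsNilpotent z := by
  have hpow : ∀ n : ℕ, x * y ^ n - y ^ n * x = z * ((n : ℂ) • y ^ (n - 1)) := by
    intro n
    induction n with
    | zero => simp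
    | succ n ih =>
      have e1 : x * y ^ (n + 1) - y ^ (n + 1) * x =
          (x * y ^ n - y ^ n * x) * y + y ^ n * (x * y - y * x) := by
        rw [pow_succ]; noncomm_ring
      rw [e1, ih, h, (hy.pow_left n).eq, Nat.add_sub_cancel]
      rcases n with _ | n
      · simp
      · rw [Nat.add_sub_cancel, mul_assoc, smul_mul_assoc, ← pow_succ, ← mul_add]
        congr 1; push_cast; module
  have hpoly : ∀ p : Polynomial ℂ, x * Polynomial.aeval y p - Polynomial.aeval y p * x =
      z * Polynomial.aeval y (Polynomial.derivative p) := by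
    intro p
    induction p using Polynomial.induction_on' with
    | add p q hp hq =>
      rw [map_add, mul_add, add_mul, Polynomial.derivative_add, map_add, mul_add, ← hp, ← hq]
      abel
    | monomial n a =>
      rw [Polynomial.derivative_monomial, Polynomial.aeval_monomial, Polynomial.aeval_monomial,
        ← Algebra.smul_def, ← Algebra.smul_def, mul_smul_comm, smul_mul_assoc, ← smul_sub, hpow n,
        ← mul_smul_comm, smul_smul]
  have hint : IsIntegral ℂ y := Algebra.IsIntegral.isIntegral y
  set p := minpoly ℂ y
  have hit : ∀ k : ℕ, z ^ k * Polynomial.aeval y (Polynomial.derivative^[k] p) = 0 := by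
    intro k
    induction k with
    | zero => simp [p]
    | succ k ih =>
      rw [Function.iterate_succ_apply', pow_succ, mul_assoc, ← hpoly, mul_sub, ← mul_assoc,
        ← mul_assoc, ih, zero_mul, sub_zero, ← (hx.pow_right k).eq, mul_assoc, ih, mul_zero]
  have hd := hit p.natDegree
  have hder : Polynomial.derivative^[p.natDegree] p = Polynomial.C (p.natDegree.factorial : ℂ) := by
    rw [Polynomial.eq_C_of_natDegree_eq_zero (p := Polynomial.derivative^[p.natDegree] p)
      (by have := Polynomial.natDegree_iterate_derivative p p.natDegree; omega),
      Polynomial.coeff_iterate_derivative, zero_add,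
      (minpoly.monic hint).coeff_natDegree, Nat.descFactorial_self]
    simp
  rw [hder, Polynomial.aeval_C, Algebra.algebraMap_eq_smul_one, mul_smul_comm, mul_one] at hd
  exact ⟨_, (smul_eq_zero.mp hd).resolve_left (by exact_mod_cast Nat.factorial_ne_zero _)⟩

/-- If N is the nilpotent part of A = ad x, then ad N = P(ad A) on `End L` for a polynomial P. Hence
M = P(A) satisfies ad(My) = [N, ad y], so M is a derivation and therefore inner. -/
theorem exists_jordan_decomposition [FiniteDimensional ℂ L] [LieAlgebra.IsKilling ℂ L] (x : L) :
    ∃ n : L, IsNilpotentElem n ∧ IsSemisimpleElem (x - n) ∧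
      LieAlgebra.ad ℂ L n ∈ Algebra.adjoin ℂ {LieAlgebra.ad ℂ L x} := by
  set A := LieAlgebra.ad ℂ L x with hA
  obtain ⟨N, hNA, S, hSA, hN, hS, hNS⟩ := A.exists_isNilpotent_isSemisimple
  have hc : Commute N S := Algebra.commute_of_mem_adjoin_singleton_of_commute hSA
      (Algebra.commute_of_mem_adjoin_self hNA).symm
  have hadj := LieAlgebra.ad_mem_adjoin_of_isNilpotent hc hN hS
  rw [← hNS, Algebra.adjoin_singleton_eq_range_aeval] at hadj
  obtain ⟨P, hP⟩ := hadj
  have hP : Polynomial.aeval (LieAlgebra.ad ℂ (Module.End ℂ L) A) P =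
    LieAlgebra.ad ℂ (Module.End ℂ L) N := hP
  have key : ∀ (Q : Polynomial ℂ) (y : L),
      Polynomial.aeval (LieAlgebra.ad ℂ (Module.End ℂ L) A) Q (LieAlgebra.ad ℂ L y) =
        LieAlgebra.ad ℂ L (Polynomial.aeval A Q y) := by
    intro Q y
    induction Q using Polynomial.induction_on' with
    | add p q hp hq => rw [map_add, map_add, LinearMap.add_apply, LinearMap.add_apply, map_add,
        hp, hq]
    | monomial n a =>
      rw [Polynomial.aeval_monomial, Polynomial.aeval_monomial, ← Algebra.smul_def,
        ← Algebra.smul_def, LinearMap.smul_apply, LinearMap.smul_apply, map_smul]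
      congr 1
      induction n with
      | zero => simp
      | succ n ih =>
        rw [pow_succ', pow_succ', Module.End.mul_apply, Module.End.mul_apply, ih,
          LieAlgebra.ad_apply, hA, ← LieHom.map_lie]
        rfl
  have hinj : ∀ y : L, LieAlgebra.ad ℂ L y = 0 → y = 0 := fun y hy =>
    (LieDerivation.IsKilling.ad_apply_eq_zero_iff ℂ L y).mp
      (LieDerivation.ext fun z => by simpa using LinearMap.congr_fun hy z)
  -- Polynomial identities for `ad A` on `End L` descend to `A`, since `ad` embeds `L`. Both
  -- nilpotency of `M` and semisimplicity of `A - M` are obtained this way.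
  have hzero : ∀ Q : Polynomial ℂ,
      Polynomial.aeval (LieAlgebra.ad ℂ (Module.End ℂ L) A) Q = 0 → Polynomial.aeval A Q = 0 := by
    intro Q hQ
    ext y
    apply hinj
    rw [← key, hQ, LinearMap.zero_apply]
  set M := Polynomial.aeval A P with hM
  have hMad : ∀ y, LieAlgebra.ad ℂ L (M y) = ⁅N, LieAlgebra.ad ℂ L y⁆ := by
    intro y
    rw [hM, ← key, hP, LieAlgebra.ad_apply]
  let D : LieDerivation ℂ L L :=
    { toLinearMap := M
      leibniz' := fun a b => by
        rw [← sub_eq_zero]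
        apply hinj
        rw [map_sub, map_sub, hMad, LieHom.map_lie, LieHom.map_lie, LieHom.map_lie, hMad, hMad,
          leibniz_lie, ← lie_skew ⁅N, LieAlgebra.ad ℂ L a⁆]
        abel }
  obtain ⟨n, hn⟩ := LieDerivation.IsKilling.exists_eq_ad D
  have hnM : LieAlgebra.ad ℂ L n = M := by
    ext y
    have := LieDerivation.congr_fun hn y
    simpa [D] using this
  refine ⟨n, ?_, ?_, ?_⟩
  · obtain ⟨k, hk⟩ := LieAlgebra.ad_nilpotent_of_nilpotent (R := ℂ) hN
    refine ⟨k, ?_⟩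
    rw [hnM, hM, ← map_pow]
    apply hzero
    rw [map_pow, hP, hk]
  · have hss : (LieAlgebra.ad ℂ (Module.End ℂ L) S).IsSemisimple :=
      LieAlgebra.ad_isSemisimple_of_isSemisimple hS
    have hXP : Polynomial.aeval (LieAlgebra.ad ℂ (Module.End ℂ L) A) (Polynomial.X - P) =
        LieAlgebra.ad ℂ (Module.End ℂ L) S := by
      rw [map_sub, Polynomial.aeval_X, hP, ← map_sub, hNS, add_sub_cancel_left]
    unfold IsSemisimpleElem
    rw [map_sub, hnM, ← hA]
    refine Module.End.isSemisimple_of_squarefree_aeval_eq_zero hss.minpoly_squarefree ?_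
    have : A - M = Polynomial.aeval A (Polynomial.X - P) := by simp [hM]
    rw [this, ← Polynomial.aeval_comp]
    apply hzero
    rw [Polynomial.aeval_comp, hXP, minpoly.aeval]
  · rw [hnM, hM]
    exact Polynomial.aeval_mem_adjoin_singleton ℂ A

/-! ### Solvable extensions and Borel subalgebras -/

theorem isSolvable_of_ker {M N : Type*} [LieRing M] [LieAlgebra ℂ M] [LieRing N] [LieAlgebra ℂ N]
    (F : M →ₗ⁅ℂ⁆ N) [LieAlgebra.IsSolvable F.ker] [LieAlgebra.IsSolvable N] :
    LieAlgebra.IsSolvable M := by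
  obtain ⟨k, hk⟩ := LieAlgebra.IsSolvable.solvable ℂ N
  obtain ⟨l, hl⟩ := LieAlgebra.IsSolvable.solvable ℂ F.ker
  rw [LieIdeal.derivedSeries_eq_bot_iff] at hl
  have h1 : LieAlgebra.derivedSeries ℂ M k ≤ F.ker := by
    rw [LieHom.le_ker_iff]
    intro x hx
    have h2 := LieIdeal.derivedSeries_map_le k (f := F)
    rw [hk] at h2
    have := h2 (LieIdeal.mem_map (f := F) hx)
    simpa using this
  refine LieAlgebra.IsSolvable.mk (R := ℂ) (k := l + k) ?_
  rw [LieAlgebra.derivedSeries_def, LieAlgebra.derivedSeriesOfIdeal_add, eq_bot_iff, ← hl]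
  exact LieAlgebra.derivedSeriesOfIdeal_mono h1 l

/-- In K + A the subalgebra A is a solvable ideal, and the quotient by it is an image of K. -/
theorem exists_solvable_sup {K A : LieSubalgebra ℂ L} (hK : LieAlgebra.IsSolvable K)
    (hA : LieAlgebra.IsSolvable A) (h : ∀ x ∈ K, ∀ y ∈ A, ⁅x, y⁆ ∈ A) :
    ∃ s : LieSubalgebra ℂ L, LieAlgebra.IsSolvable s ∧ K ≤ s ∧ A ≤ s := by
  have h' : ∀ y ∈ A, ∀ x ∈ K, ⁅y, x⁆ ∈ A := fun y hy x hx => by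
    rw [← lie_skew]; exact neg_mem (h x hx y hy)
  let s : LieSubalgebra ℂ L :=
    { K.toSubmodule ⊔ A.toSubmodule with
      lie_mem' := by
        intro u v hu hv
        obtain ⟨x, hx, y, hy, rfl⟩ := Submodule.mem_sup.mp hu
        obtain ⟨x', hx', y', hy', rfl⟩ := Submodule.mem_sup.mp hv
        refine Submodule.mem_sup.mpr ⟨⁅x, x'⁆, K.lie_mem hx hx',
          ⁅x, y'⁆ + ⁅y, x'⁆ + ⁅y, y'⁆,
          A.add_mem (A.add_mem (h x hx y' hy') (h' y hy x' hx')) (A.lie_mem hy hy'), ?_⟩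
        simp only [lie_add, add_lie]; abel }
  have hmem : ∀ z, z ∈ s ↔ ∃ x ∈ K, ∃ y ∈ A, x + y = z := fun z => Submodule.mem_sup
  have hKs : K ≤ s := fun x hx => (hmem x).mpr ⟨x, hx, 0, A.zero_mem, add_zero x⟩
  have hAs : A ≤ s := fun x hx => (hmem x).mpr ⟨0, K.zero_mem, x, hx, zero_add x⟩
  let I : LieIdeal ℂ s :=
    { A.toSubmodule.comap s.toSubmodule.subtype with
      lie_mem := by
        rintro ⟨u, hu⟩ ⟨v, hv'⟩ hv
        obtain ⟨x, hx, y, hy, rfl⟩ := (hmem u).mp hu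
        change ⁅x + y, v⁆ ∈ A
        rw [add_lie]
        exact A.add_mem (h x hx v hv) (A.lie_mem hy hv) }
  refine ⟨s, ?_, hKs, hAs⟩
  have hI : LieAlgebra.IsSolvable I := by
    let g : I →ₗ⁅ℂ⁆ A :=
      { toFun := fun z => ⟨z.1.1, z.2⟩
        map_add' := fun _ _ => rfl
        map_smul' := fun _ _ => rfl
        map_lie' := rfl }
    refine Function.Injective.lieAlgebra_isSolvable (f := g) fun a b hab => ?_
    exact Subtype.ext (Subtype.ext (congrArg (fun c : A => (c : L)) hab))
  let π : s →ₗ⁅ℂ⁆ s ⧸ I :=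
    { (LieSubmodule.Quotient.mk' I : s →ₗ[ℂ] s ⧸ I) with
      map_lie' := fun {x y} => LieSubmodule.Quotient.mk_bracket I x y }
  have hπ : ∀ x, π x = 0 ↔ x ∈ I := fun x => LieSubmodule.Quotient.mk_eq_zero I
  have hker : π.ker = I := by
    ext x; rw [LieHom.mem_ker, hπ]
  have : LieAlgebra.IsSolvable π.ker := by rw [hker]; exact hI
  have : LieAlgebra.IsSolvable (s ⧸ I) := by
    refine Function.Surjective.lieAlgebra_isSolvable (f := π.comp (LieSubalgebra.inclusion hKs))
      fun z => ?_
    obtain ⟨⟨u, hu⟩, rfl⟩ : ∃ u, π u = z := LieSubmodule.Quotient.surjective_mk' I z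
    obtain ⟨x, hx, y, hy, rfl⟩ := (hmem u).mp hu
    refine ⟨⟨x, hx⟩, ?_⟩
    rw [← sub_eq_zero, LieHom.comp_apply, ← map_sub, hπ]
    change x - (x + y) ∈ A
    simpa using hy
  exact isSolvable_of_ker π

theorem IsBorel.le_of_normalized {b : LieSubalgebra ℂ L} (hb : IsBorel b) {A : LieSubalgebra ℂ L}
    (hA : LieAlgebra.IsSolvable A) (h : ∀ x ∈ b, ∀ y ∈ A, ⁅x, y⁆ ∈ A) : A ≤ b := by
  obtain ⟨s, hs, h1, h2⟩ := exists_solvable_sup hb.prop hA h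
  exact h2.trans (hb.le_of_ge hs h1)

theorem IsBorel.mem_of_normalizes {b : LieSubalgebra ℂ L} (hb : IsBorel b) {n : L}
    (h : ∀ x ∈ b, ⁅n, x⁆ ∈ b) : n ∈ b := by
  let K : LieSubalgebra ℂ L :=
    { ℂ ∙ n with
      lie_mem' := by
        intro u v hu hv
        obtain ⟨c, rfl⟩ := Submodule.mem_span_singleton.mp hu
        obtain ⟨d, rfl⟩ := Submodule.mem_span_singleton.mp hv
        simp }
  have hKn : n ∈ K := Submodule.mem_span_singleton_self n
  have hK : ∀ x ∈ K, ∃ c : ℂ, c • n = x := fun x hx => Submodule.mem_span_singleton.mp hx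
  have hab : IsLieAbelian K := ⟨by
    rintro ⟨x, hx⟩ ⟨y, hy⟩
    obtain ⟨c, rfl⟩ := hK x hx
    obtain ⟨d, rfl⟩ := hK y hy
    apply Subtype.ext
    simp⟩
  obtain ⟨s, hs, h1, h2⟩ := exists_solvable_sup (K := K) (A := b) inferInstance hb.prop (by
    intro x hx y hy
    obtain ⟨c, rfl⟩ := hK x hx
    rw [smul_lie]
    exact b.smul_mem c (h y hy))
  exact hb.le_of_ge hs h2 (h1 hKn)

theorem mem_gradedPiece_iff {h x : L} {i : ℤ} : x ∈ gradedPiece h i ↔ ⁅h, x⁆ = (i : ℂ) • x :=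
  Module.End.mem_eigenspace_iff

namespace IsExtremalTriple

variable {h e f : L} (t : IsExtremalTriple h e f)
include t

/-- The solvable algebra g(1) ⊕ ℂe is normalised by all nonnegative degrees, so maximality puts it
in `b`. Then [h,b] ⊆ g(1) ⊕ ℂe ⊆ b, and `h` normalises `b`. -/
theorem borel_contains {b : LieSubalgebra ℂ L} (hb : IsBorel b)
    (hdec : ∀ x ∈ b, ∃ x₀ x₁ x₂ : L, ⁅h, x₀⁆ = 0 ∧ ⁅h, x₁⁆ = (1 : ℂ) • x₁ ∧
      ⁅h, x₂⁆ = (2 : ℂ) • x₂ ∧ x = x₀ + x₁ + x₂) :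
    h ∈ b ∧ e ∈ b ∧ ∀ v : L, ⁅h, v⁆ = (1 : ℂ) • v → v ∈ b := by
  let A : LieSubalgebra ℂ L :=
    { carrier := {x | ∃ (v : L) (c : ℂ), ⁅h, v⁆ = (1 : ℂ) • v ∧ x = v + c • e}
      zero_mem' := ⟨0, 0, by simp, by simp⟩
      add_mem' := by
        rintro _ _ ⟨v, c, hv, rfl⟩ ⟨w, d, hw, rfl⟩
        exact ⟨v + w, c + d, by rw [lie_add, hv, hw, smul_add], by module⟩
      smul_mem' := by
        rintro r _ ⟨v, c, hv, rfl⟩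
        exact ⟨r • v, r * c, by rw [lie_smul, hv, smul_comm], by module⟩
      lie_mem' := by
        rintro _ _ ⟨v, c, hv, rfl⟩ ⟨w, d, hw, rfl⟩
        obtain ⟨r, hr⟩ := t.exists_lie_eq_smul_e hv hw
        refine ⟨0, r, by simp, ?_⟩
        have h1 := t.lie_e_eq_zero_of_weight hv
        have h2 := t.lie_e_eq_zero_of_weight hw
        simp only [add_lie, lie_add, smul_lie, lie_smul, hr, h2, lie_self, ← lie_skew v e, h1]
        simp }
  have hAmem : ∀ x, x ∈ A ↔ ∃ (v : L) (c : ℂ), ⁅h, v⁆ = (1 : ℂ) • v ∧ x = v + c • e :=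
    fun x => Iff.rfl
  have hlie : ∀ x ∈ A, ∀ y ∈ A, ∃ r : ℂ, ⁅x, y⁆ = r • e := by
    rintro _ ⟨v, c, hv, rfl⟩ _ ⟨w, d, hw, rfl⟩
    obtain ⟨r, hr⟩ := t.exists_lie_eq_smul_e hv hw
    refine ⟨r, ?_⟩
    have h1 := t.lie_e_eq_zero_of_weight hv
    have h2 := t.lie_e_eq_zero_of_weight hw
    simp only [add_lie, lie_add, smul_lie, lie_smul, hr, h2, lie_self, ← lie_skew v e, h1]
    simp
  have hlie' : ∀ x ∈ A, ⁅x, e⁆ = 0 := by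
    rintro _ ⟨v, c, hv, rfl⟩
    rw [add_lie, ← lie_skew, t.lie_e_eq_zero_of_weight hv]; simp
  have hA : LieAlgebra.IsSolvable A := by
    let J : LieIdeal ℂ A :=
      { (ℂ ∙ e).comap A.toSubmodule.subtype with
        lie_mem := by
          rintro ⟨x, hx⟩ ⟨y, hy⟩ -
          obtain ⟨r, hr⟩ := hlie x hx y hy
          exact Submodule.mem_span_singleton.mpr ⟨r, hr.symm⟩ }
    have hJ : ∀ x : A, x ∈ J → ∃ r : ℂ, r • e = x := fun x hx => Submodule.mem_span_singleton.mp hx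
    refine LieAlgebra.IsSolvable.mk (R := ℂ) (k := 2) ?_
    rw [LieAlgebra.derivedSeries_def, LieAlgebra.derivedSeriesOfIdeal_succ,
      LieAlgebra.derivedSeriesOfIdeal_succ, LieAlgebra.derivedSeriesOfIdeal_zero, eq_bot_iff]
    have h1 : ⁅(⊤ : LieIdeal ℂ A), (⊤ : LieIdeal ℂ A)⁆ ≤ J := by
      rw [LieSubmodule.lie_le_iff]
      rintro ⟨x, hx⟩ - ⟨y, hy⟩ -
      obtain ⟨r, hr⟩ := hlie x hx y hy
      exact Submodule.mem_span_singleton.mpr ⟨r, hr.symm⟩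
    refine (LieSubmodule.mono_lie h1 h1).trans ?_
    rw [LieSubmodule.lie_le_iff]
    intro x _ y hy
    obtain ⟨r, hr⟩ := hJ y hy
    refine (LieSubmodule.mem_bot _).mpr (Subtype.ext ?_)
    change ⁅(x : L), (y : L)⁆ = 0
    rw [← hr, lie_smul, hlie' x x.2, smul_zero]
  have hAb : A ≤ b := by
    refine hb.le_of_normalized hA ?_
    rintro x hx _ ⟨v, c, hv, rfl⟩
    obtain ⟨x₀, x₁, x₂, h0, h1, h2, rfl⟩ := hdec x hx
    obtain ⟨r, rfl⟩ := t.exists_smul_e_of_weight h2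
    obtain ⟨r₁, hr₁⟩ := t.exists_lie_eq_smul_e h1 hv
    obtain ⟨r₀, hr₀⟩ := t.exists_smul_e_of_weight (x := ⁅x₀, e⁆)
      (by rw [leibniz_lie, h0, zero_lie, zero_add, t.lie_h_e', lie_smul])
    refine ⟨⁅x₀, v⁆, r₁ + c * r₀, by rw [leibniz_lie, h0, zero_lie, zero_add, hv, lie_smul], ?_⟩
    have e1 := t.lie_e_eq_zero_of_weight h1
    have ev := t.lie_e_eq_zero_of_weight hv
    simp only [add_lie, lie_add, smul_lie, lie_smul, hr₁, hr₀, lie_self, ← lie_skew x₁ e, e1, ev]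
    module
  have heb : e ∈ b := hAb ⟨0, 1, by simp, by simp⟩
  have h1b : ∀ v : L, ⁅h, v⁆ = (1 : ℂ) • v → v ∈ b := fun v hv => hAb ⟨v, 0, hv, by simp⟩
  refine ⟨hb.mem_of_normalizes fun x hx => ?_, heb, h1b⟩
  obtain ⟨x₀, x₁, x₂, h0, h1, h2, rfl⟩ := hdec x hx
  obtain ⟨r, rfl⟩ := t.exists_smul_e_of_weight h2
  rw [lie_add, lie_add, h0, h1, h2]
  exact b.add_mem (b.add_mem b.zero_mem (b.smul_mem _ (h1b _ h1)))
    (b.smul_mem _ (b.smul_mem _ heb))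

end IsExtremalTriple

/-! ### Reductive linear Lie algebras -/

section Reductive

variable {S : Type*} [LieRing S] [LieAlgebra ℂ S] [FiniteDimensional ℂ S]
  {V : Type*} [AddCommGroup V] [Module ℂ V] [FiniteDimensional ℂ V] (F : S →ₗ⁅ℂ⁆ Module.End ℂ V)

theorem mem_center_iff' {M : Type*} [LieRing M] [LieAlgebra ℂ M] {z : M} :
    z ∈ LieAlgebra.center ℂ M ↔ ∀ x : M, ⁅x, z⁆ = 0 :=
  LieModule.mem_maxTrivSubmodule ..

/-- The kernel is central, so the preimage of the radical of the image is a solvable ideal of `S`,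
hence central. -/
theorem isReductiveLinear_range (hS : LieAlgebra.HasCentralRadical ℂ S)
    (hss : ∀ z ∈ LieAlgebra.center ℂ S, (F z).IsSemisimple)
    (hker : ∀ x, F x = 0 → x ∈ LieAlgebra.center ℂ S) : IsReductiveLinear F.range := by
  let G : S →ₗ⁅ℂ⁆ F.range := F.rangeRestrict
  have hG : Function.Surjective G := F.surjective_rangeRestrict
  let R := LieAlgebra.radical ℂ F.range
  let J : LieIdeal ℂ S := R.comap G
  have hJmem : ∀ x, x ∈ J ↔ G x ∈ R := fun x => LieIdeal.mem_comap
  let g : J →ₗ⁅ℂ⁆ R :=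
    { toFun := fun z => ⟨G z, (hJmem z).mp z.2⟩
      map_add' := fun x y => Subtype.ext (map_add G _ _)
      map_smul' := fun c x => Subtype.ext (map_smul G _ _)
      map_lie' := fun {x y} => Subtype.ext (LieHom.map_lie G _ _) }
  have hab : IsLieAbelian g.ker := ⟨by
    rintro ⟨x, hx⟩ ⟨y, hy⟩
    have h0 : F y = 0 := by
      have h1 : G y = 0 := congrArg Subtype.val ((LieHom.mem_ker ..).mp hy)
      exact congrArg Subtype.val h1
    have := mem_center_iff'.mp (hker y h0) x
    exact Subtype.ext (Subtype.ext this)⟩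
  have hJs : LieAlgebra.IsSolvable J := isSolvable_of_ker g
  have hJ : J ≤ LieAlgebra.center ℂ S := by
    rw [← hS.radical_eq_center]
    exact (LieAlgebra.LieIdeal.solvable_iff_le_radical ℂ S J).mp hJs
  have hR : LieAlgebra.HasCentralRadical ℂ F.range := by
    refine LieAlgebra.hasCentralRadical_of_radical_le _ _ fun x hx => ?_
    obtain ⟨a, rfl⟩ := hG x
    have ha := mem_center_iff'.mp (hJ ((hJmem a).mpr hx))
    refine mem_center_iff'.mpr fun y => ?_
    obtain ⟨b, rfl⟩ := hG y
    rw [← LieHom.map_lie, ha, map_zero]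
  refine ⟨hR, fun x hx => ?_⟩
  obtain ⟨a, rfl⟩ := hG x
  rw [← hR.radical_eq_center] at hx
  exact hss a (hJ ((hJmem a).mpr hx))

/-- The radical of `S` maps to a solvable, hence central, ideal of the image. Its brackets with `S`
therefore die under `F`, and `hker` makes them zero. -/
theorem IsReductiveLinear.of_range (h : IsReductiveLinear F.range)
    (hker : ∀ x y : S, F ⁅x, y⁆ = 0 → ⁅x, y⁆ = 0) :
    LieAlgebra.HasCentralRadical ℂ S ∧
      ∀ z ∈ LieAlgebra.center ℂ S, (F z).IsSemisimple := by
  let G : S →ₗ⁅ℂ⁆ F.range := F.rangeRestrict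
  have hG : Function.Surjective G := F.surjective_rangeRestrict
  obtain ⟨hR, hss⟩ := h
  let R := LieAlgebra.radical ℂ S
  let J : LieIdeal ℂ F.range :=
    { R.toSubmodule.map (G : S →ₗ[ℂ] F.range) with
      lie_mem := by
        rintro x _ ⟨a, ha, rfl⟩
        obtain ⟨b, rfl⟩ := hG x
        exact ⟨⁅b, a⁆, R.lie_mem ha, LieHom.map_lie G b a⟩ }
  let g : R →ₗ⁅ℂ⁆ J :=
    { toFun := fun z => ⟨G z, z, z.2, rfl⟩
      map_add' := fun x y => Subtype.ext (map_add G _ _)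
      map_smul' := fun c x => Subtype.ext (map_smul G _ _)
      map_lie' := fun {x y} => Subtype.ext (LieHom.map_lie G _ _) }
  have hJs : LieAlgebra.IsSolvable J := by
    refine Function.Surjective.lieAlgebra_isSolvable (f := g) ?_
    rintro ⟨_, a, ha, rfl⟩
    exact ⟨⟨a, ha⟩, rfl⟩
  have hJ : J ≤ LieAlgebra.center ℂ F.range := by
    rw [← hR.radical_eq_center]
    exact (LieAlgebra.LieIdeal.solvable_iff_le_radical ℂ F.range J).mp hJs
  refine ⟨LieAlgebra.hasCentralRadical_of_radical_le _ _ fun a ha => ?_, fun z hz => ?_⟩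
  · have h1 := mem_center_iff'.mp (hJ ⟨a, ha, rfl⟩)
    refine mem_center_iff'.mpr fun y => hker y a ?_
    have h2 := congrArg Subtype.val (h1 (G y))
    rw [LieHom.map_lie]
    exact h2
  · refine hss (G z) (mem_center_iff'.mpr fun y => ?_)
    obtain ⟨b, rfl⟩ := hG y
    rw [← LieHom.map_lie, mem_center_iff'.mp hz, map_zero]

theorem IsReductiveLinear.map_lieConj {W : Type*} [AddCommGroup W] [Module ℂ W]
    [FiniteDimensional ℂ W] (ε : V ≃ₗ[ℂ] W) {T : LieSubalgebra ℂ (Module.End ℂ V)}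
    (hT : IsReductiveLinear T) : IsReductiveLinear (T.map ε.lieConj.toLieHom) := by
  have hr : T.map ε.lieConj.toLieHom = (ε.lieConj.toLieHom.comp T.incl).range := by
    ext x
    simp [LieSubalgebra.mem_map]
  rw [hr]
  refine isReductiveLinear_range _ hT.1 (fun z hz => ?_) fun x hx => ?_
  · refine (LinearEquiv.isSemisimple_iff (z : Module.End ℂ V) _ ε ?_).mp (hT.2 z hz)
    ext v
    simp [LinearEquiv.lieConj_apply, LinearEquiv.conj_apply]
  · have : x = 0 := Subtype.ext (ε.lieConj.injective (hx.trans (map_zero _).symm))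
    rw [this]; exact zero_mem _

theorem IsReductiveType.comp_equiv {q q' : Type*} [LieRing q] [LieAlgebra ℂ q]
    [FiniteDimensional ℂ q] [LieRing q'] [LieAlgebra ℂ q'] [FiniteDimensional ℂ q']
    (ψ : q ≃ₗ⁅ℂ⁆ q') {γ : Module.Dual ℂ q'} (h : IsReductiveType γ) :
    IsReductiveType (γ ∘ₗ (ψ.toLinearEquiv : q →ₗ[ℂ] q')) := by
  have := IsReductiveLinear.map_lieConj ψ.symm.toLinearEquiv h
  unfold IsReductiveType
  convert this using 1
  ext A
  constructor
  · rintro ⟨x, hx, rfl⟩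
    refine ⟨LieAlgebra.ad ℂ q' (ψ x), ⟨ψ x, fun y => ?_, rfl⟩, ?_⟩
    · obtain ⟨z, rfl⟩ := ψ.surjective y
      change γ ⁅ψ x, ψ z⁆ = 0
      rw [← LieEquiv.map_lie]
      exact hx z
    · ext y
      change ψ.symm ⁅ψ x, ψ y⁆ = ⁅x, y⁆
      rw [← LieEquiv.map_lie, LieEquiv.symm_apply_apply]
  · rintro ⟨_, ⟨x, hx, rfl⟩, rfl⟩
    refine ⟨ψ.symm x, fun y => ?_, ?_⟩
    · have : ∀ z, γ ⁅x, z⁆ = 0 := hx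
      change γ (ψ ⁅ψ.symm x, y⁆) = 0
      rw [LieEquiv.map_lie, LieEquiv.apply_symm_apply]
      exact this (ψ y)
    · ext y
      change ⁅ψ.symm x, y⁆ = ψ.symm ⁅x, ψ y⁆
      rw [LieEquiv.map_lie, LieEquiv.symm_apply_apply]

end Reductive

/-! ### Stabilisers of restricted linear forms -/

/-- The restriction to a subalgebra of a linear form on `L`. -/
def restrictForm (p : LieSubalgebra ℂ L) (Γ : Module.Dual ℂ L) : Module.Dual ℂ p :=
  Γ ∘ₗ p.toSubmodule.subtype

/-- Forms on all of `L` can be restricted to p and to the reduced subalgebra simultaneously. -/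
theorem exists_restrictForm_eq {p : LieSubalgebra ℂ L} (γ : Module.Dual ℂ p) :
    ∃ Γ : Module.Dual ℂ L, γ = restrictForm p Γ := by
  obtain ⟨Γ, hΓ⟩ := LinearMap.exists_extend (p := p.toSubmodule) γ
  exact ⟨Γ, hΓ.symm⟩

/-- The stabiliser in `p` of the restriction of `Γ` to `p`, as a subalgebra of `L`. -/
def formStabilizer (p : LieSubalgebra ℂ L) (Γ : Module.Dual ℂ L) : LieSubalgebra ℂ L :=
  (coadjointStabilizer (restrictForm p Γ)).map p.incl

theorem mem_formStabilizer {p : LieSubalgebra ℂ L} {Γ : Module.Dual ℂ L} {x : L} :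
    x ∈ formStabilizer p Γ ↔ x ∈ p ∧ ∀ y ∈ p, Γ ⁅x, y⁆ = 0 := by
  constructor
  · rintro ⟨x, hx, rfl⟩
    exact ⟨x.2, fun y hy => hx ⟨y, hy⟩⟩
  · rintro ⟨hx, h⟩
    exact ⟨⟨x, hx⟩, fun y => h y y.2, rfl⟩

theorem formStabilizer_le (p : LieSubalgebra ℂ L) (Γ : Module.Dual ℂ L) : formStabilizer p Γ ≤ p :=
  fun _ hx => (mem_formStabilizer.mp hx).1

/-- The adjoint action of a subalgebra `s` on a subalgebra containing it. -/
def adOn {s p : LieSubalgebra ℂ L} (hs : s ≤ p) : s →ₗ⁅ℂ⁆ Module.End ℂ p :=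
  (LieAlgebra.ad ℂ p).comp (LieSubalgebra.inclusion hs)

theorem isReductiveType_restrictForm_iff {p s : LieSubalgebra ℂ L} {Γ : Module.Dual ℂ L}
    (h : s = formStabilizer p Γ) (hs : s ≤ p) :
    IsReductiveType (restrictForm p Γ) ↔ IsReductiveLinear (adOn hs).range := by
  unfold IsReductiveType
  have : (coadjointStabilizer (restrictForm p Γ)).map (LieAlgebra.ad ℂ p) = (adOn hs).range := by
    ext A
    constructor
    · rintro ⟨x, hx, rfl⟩
      exact ⟨⟨x, h ▸ ⟨x, hx, rfl⟩⟩, rfl⟩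
    · rintro ⟨⟨x, hx⟩, rfl⟩
      refine ⟨⟨x, hs hx⟩, fun y => ?_, rfl⟩
      have hx' : x ∈ formStabilizer p Γ := h ▸ hx
      exact (mem_formStabilizer.mp hx').2 y y.2
  rw [this]

theorem isNilpotentType_restrictForm_iff {p : LieSubalgebra ℂ L} {Γ : Module.Dual ℂ L} :
    IsNilpotentType (restrictForm p Γ) ↔ ∀ x ∈ formStabilizer p Γ, Γ x = 0 := by
  constructor
  · rintro h _ ⟨x, hx, rfl⟩
    exact h x hx
  · intro h x hx
    exact h x ⟨x, hx, rfl⟩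

theorem mem_MStar_iff {p r : LieSubalgebra ℂ L} :
    r ∈ MStar p ↔ IsStronglyQuasiReductive p ∧ ∃ Γ : Module.Dual ℂ L,
      IsReductiveType (restrictForm p Γ) ∧ (∀ x ∈ formStabilizer p Γ, Γ x = 0) ∧
        r = formStabilizer p Γ := by
  refine and_congr_right fun _ => ⟨?_, ?_⟩
  · rintro ⟨γ, h1, h2, h3⟩
    obtain ⟨Γ, rfl⟩ := exists_restrictForm_eq γ
    exact ⟨Γ, h1, isNilpotentType_restrictForm_iff.mp h2, h3⟩
  · rintro ⟨Γ, h1, h2, h3⟩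
    exact ⟨_, h1, isNilpotentType_restrictForm_iff.mpr h2, h3⟩

theorem mem_of_map_eq {p : LieSubalgebra ℂ L} {φ : L ≃ₗ⁅ℂ⁆ L} (h : p.map φ.toLieHom = p) {x : L} :
    φ x ∈ p ↔ x ∈ p := by
  constructor
  · intro hx
    rw [← h] at hx
    obtain ⟨y, hy, hyx⟩ := hx
    rwa [← φ.injective hyx]
  · intro hx
    rw [← h]
    exact ⟨x, hx, rfl⟩

theorem InParabolicSubgroup.symm {p : LieSubalgebra ℂ L} {φ : L ≃ₗ⁅ℂ⁆ L}
    (h : InParabolicSubgroup p φ) : InParabolicSubgroup p φ.symm := by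
  refine ⟨.symm _ h.1, ?_⟩
  ext x
  constructor
  · rintro ⟨y, hy, rfl⟩
    refine (mem_of_map_eq h.2).mp ?_
    change φ (φ.symm y) ∈ p
    rwa [LieEquiv.apply_symm_apply]
  · intro hx
    exact ⟨φ x, (mem_of_map_eq h.2).mpr hx, LieEquiv.symm_apply_apply φ x⟩

theorem isReductiveType_comp [FiniteDimensional ℂ L] {p : LieSubalgebra ℂ L} {φ : L ≃ₗ⁅ℂ⁆ L}
    (h : p.map φ.toLieHom = p) {Γ : Module.Dual ℂ L} (hΓ : IsReductiveType (restrictForm p Γ)) :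
    IsReductiveType (restrictForm p (Γ ∘ₗ (φ.toLinearEquiv : L →ₗ[ℂ] L))) := by
  let ψ : p ≃ₗ⁅ℂ⁆ p :=
    { toFun := fun x => ⟨φ x, (mem_of_map_eq h).mpr x.2⟩
      map_add' := fun x y => Subtype.ext (map_add φ _ _)
      map_smul' := fun c x => Subtype.ext (map_smul φ _ _)
      map_lie' := fun {x y} => Subtype.ext (LieEquiv.map_lie φ _ _)
      invFun := fun x => ⟨φ.symm x, (mem_of_map_eq h).mp (by
        rw [LieEquiv.apply_symm_apply]; exact x.2)⟩
      left_inv := fun x => Subtype.ext (LieEquiv.symm_apply_apply φ _)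
      right_inv := fun x => Subtype.ext (LieEquiv.apply_symm_apply φ _) }
  exact hΓ.comp_equiv ψ

theorem map_formStabilizer_comp {p : LieSubalgebra ℂ L} {φ : L ≃ₗ⁅ℂ⁆ L}
    (h : p.map φ.toLieHom = p) (Γ : Module.Dual ℂ L) :
    (formStabilizer p (Γ ∘ₗ (φ.toLinearEquiv : L →ₗ[ℂ] L))).map φ.toLieHom =
      formStabilizer p Γ := by
  ext x
  rw [mem_formStabilizer]
  constructor
  · rintro ⟨y, hy, rfl⟩
    obtain ⟨h1, h2⟩ := mem_formStabilizer.mp hy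
    refine ⟨(mem_of_map_eq h).mpr h1, fun z hz => ?_⟩
    obtain ⟨w, rfl⟩ := φ.surjective z
    have := h2 w ((mem_of_map_eq h).mp hz)
    rw [LinearMap.comp_apply] at this
    change Γ ⁅φ y, φ w⁆ = 0
    rw [← LieEquiv.map_lie]
    exact this
  · rintro ⟨h1, h2⟩
    obtain ⟨y, rfl⟩ := φ.surjective x
    refine ⟨y, mem_formStabilizer.mpr ⟨(mem_of_map_eq h).mp h1, fun z hz => ?_⟩, rfl⟩
    have := h2 (φ z) ((mem_of_map_eq h).mpr hz)
    change Γ ⁅φ y, φ z⁆ = 0 at this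
    rw [← LieEquiv.map_lie] at this
    exact this

/-! ### Semisimplicity of the adjoint action on a subalgebra -/

theorem coe_aeval_ad {p : LieSubalgebra ℂ L} (z y : p) (P : Polynomial ℂ) :
    ((Polynomial.aeval (LieAlgebra.ad ℂ p z) P y : p) : L) =
      Polynomial.aeval (LieAlgebra.ad ℂ L (z : L)) P (y : L) := by
  induction P using Polynomial.induction_on' with
  | add P Q hP hQ => rw [map_add, map_add, LinearMap.add_apply, LinearMap.add_apply, ← hP, ← hQ]; rfl
  | monomial n a =>
    rw [Polynomial.aeval_monomial, Polynomial.aeval_monomial, ← Algebra.smul_def,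
      ← Algebra.smul_def, LinearMap.smul_apply, LinearMap.smul_apply]
    refine (rfl : _ = a • (((LieAlgebra.ad ℂ p z ^ n) y : p) : L)).trans ?_
    congr 1
    induction n with
    | zero => simp
    | succ n ih =>
      rw [pow_succ', pow_succ', Module.End.mul_apply, Module.End.mul_apply, ← ih]
      rfl

section FiniteDimensional

variable [FiniteDimensional ℂ L]

/-- A squarefree polynomial in the ambient `ad z` annihilating `p` is a criterion that visibly
passes to smaller subalgebras. -/
theorem isSemisimple_ad_iff {p : LieSubalgebra ℂ L} (z : p) :
    (LieAlgebra.ad ℂ p z).IsSemisimple ↔ ∃ P : Polynomial ℂ, Squarefree P ∧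
      ∀ y ∈ p, Polynomial.aeval (LieAlgebra.ad ℂ L (z : L)) P y = 0 := by
  constructor
  · intro h
    refine ⟨_, h.minpoly_squarefree, fun y hy => ?_⟩
    rw [← coe_aeval_ad z ⟨y, hy⟩, minpoly.aeval]
    rfl
  · rintro ⟨P, hP, h⟩
    refine Module.End.isSemisimple_of_squarefree_aeval_eq_zero hP ?_
    ext y
    rw [coe_aeval_ad]
    exact h y y.2

theorem isSemisimple_ad_of_le {p q : LieSubalgebra ℂ L} (h : q ≤ p) {z : L} (hz : z ∈ q)
    (hp : (LieAlgebra.ad ℂ p ⟨z, h hz⟩).IsSemisimple) :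
    (LieAlgebra.ad ℂ q ⟨z, hz⟩).IsSemisimple := by
  obtain ⟨P, h1, h2⟩ := (isSemisimple_ad_iff _).mp hp
  exact (isSemisimple_ad_iff _).mpr ⟨P, h1, fun y hy => h2 y (h hy)⟩

theorem IsSemisimpleElem.isSemisimple_ad {p : LieSubalgebra ℂ L} {z : L} (h : IsSemisimpleElem z)
    (hz : z ∈ p) : (LieAlgebra.ad ℂ p ⟨z, hz⟩).IsSemisimple :=
  (isSemisimple_ad_iff _).mpr ⟨_, Module.End.IsSemisimple.minpoly_squarefree h, fun y _ => by
    rw [minpoly.aeval]; rfl⟩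

/-- As a polynomial in `ad z`, `ad n` preserves `p` and is there both semisimple and nilpotent. The
element `n` itself need not lie in `p`. -/
theorem lie_eq_zero_of_isSemisimple_ad {p : LieSubalgebra ℂ L} {z n : L} (hz : z ∈ p)
    (hss : (LieAlgebra.ad ℂ p ⟨z, hz⟩).IsSemisimple) (hn : IsNilpotentElem n)
    (hnz : LieAlgebra.ad ℂ L n ∈ Algebra.adjoin ℂ {LieAlgebra.ad ℂ L z}) :
    ∀ y ∈ p, ⁅n, y⁆ = 0 := by
  intro y hy
  rw [Algebra.adjoin_singleton_eq_range_aeval] at hnz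
  obtain ⟨P, hP⟩ := hnz
  have hP : Polynomial.aeval (LieAlgebra.ad ℂ L z) P = LieAlgebra.ad ℂ L n := hP
  obtain ⟨k, hk⟩ := hn
  have h0 : Polynomial.aeval (LieAlgebra.ad ℂ p ⟨z, hz⟩) P = 0 := by
    refine Module.End.eq_zero_of_isNilpotent_isSemisimple ⟨k, ?_⟩ (hss.aeval P)
    ext y
    rw [← map_pow, coe_aeval_ad, map_pow, hP, hk]
    rfl
  have := coe_aeval_ad (⟨z, hz⟩ : p) ⟨y, hy⟩ P
  rw [h0, hP] at this
  exact this.symm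

theorem lie_eq_zero_of_mem_adjoin {z n y : L} (hn : IsNilpotentElem n)
    (hnz : LieAlgebra.ad ℂ L n ∈ Algebra.adjoin ℂ {LieAlgebra.ad ℂ L z}) (hy : ⁅z, y⁆ = 0) :
    ⁅n, y⁆ = 0 := by
  have hz : z ∈ elemCentralizer z := lie_self z
  refine lie_eq_zero_of_isSemisimple_ad hz ?_ hn hnz y hy
  have : LieAlgebra.ad ℂ (elemCentralizer z) ⟨z, hz⟩ = 0 := by
    ext y
    exact y.2
  rw [this]
  exact Module.End.isSemisimple_zero

end FiniteDimensional

/-! ### Parabolic subalgebras containing `h`, `e` and the vectors of weight one -/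

theorem mem_reducedSubalgebra {h e x : L} {p : LieSubalgebra ℂ L} :
    x ∈ elemCentralizer h ⊓ elemCentralizer e ⊓ p ↔ ⁅h, x⁆ = 0 ∧ ⁅e, x⁆ = 0 ∧ x ∈ p :=
  and_assoc

/-- The properties of a parabolic subalgebra of `L` contained in the nonnegative part of the
grading defined by an extremal triple that govern its stabilisers of linear forms. -/
structure IsAdapted (h e f : L) (p : LieSubalgebra ℂ L) : Prop where
  triple : IsExtremalTriple h e f
  h_mem : h ∈ p
  e_mem : e ∈ p
  one_mem : ∀ v : L, ⁅h, v⁆ = (1 : ℂ) • v → v ∈ p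
  decomposition : ∀ x ∈ p, ∃ (a d : ℂ) (y v : L), (⁅h, y⁆ = 0 ∧ ⁅e, y⁆ = 0 ∧ y ∈ p) ∧
    ⁅h, v⁆ = (1 : ℂ) • v ∧ x = a • h + y + v + d • e
  mem_of_centralizes : ∀ n : L, ⁅h, n⁆ = 0 → ⁅e, n⁆ = 0 →
    (∀ y : L, ⁅h, y⁆ = 0 → ⁅e, y⁆ = 0 → y ∈ p → ⁅n, y⁆ = 0) → n ∈ p

theorem IsParabolic.isAdapted {h e f : L} (t : IsExtremalTriple h e f) {p : LieSubalgebra ℂ L}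
    (hp : IsParabolic p)
    (hpe : p.toSubmodule ≤ gradedPiece h 0 ⊔ gradedPiece h 1 ⊔ gradedPiece h 2) :
    IsAdapted h e f p := by
  obtain ⟨b, hb, hbp⟩ := hp
  have hdec : ∀ x ∈ p, ∃ x₀ x₁ x₂ : L, ⁅h, x₀⁆ = 0 ∧ ⁅h, x₁⁆ = (1 : ℂ) • x₁ ∧
      ⁅h, x₂⁆ = (2 : ℂ) • x₂ ∧ x = x₀ + x₁ + x₂ := by
    intro x hx
    obtain ⟨y, hy, x₂, h2, rfl⟩ := Submodule.mem_sup.mp (hpe hx)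
    obtain ⟨x₀, h0, x₁, h1, rfl⟩ := Submodule.mem_sup.mp hy
    rw [mem_gradedPiece_iff] at h0 h1 h2
    exact ⟨x₀, x₁, x₂, by simpa using h0, by simpa using h1, by simpa using h2, rfl⟩
  obtain ⟨hh, he, h1⟩ := t.borel_contains hb fun x hx => hdec x (hbp hx)
  have hdec' : ∀ x ∈ p, ∃ (a d : ℂ) (y v : L), (⁅h, y⁆ = 0 ∧ ⁅e, y⁆ = 0 ∧ y ∈ p) ∧
      ⁅h, v⁆ = (1 : ℂ) • v ∧ x = a • h + y + v + d • e := by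
    intro x hx
    obtain ⟨x₀, x₁, x₂, w0, w1, w2, rfl⟩ := hdec x hx
    obtain ⟨d, rfl⟩ := t.exists_smul_e_of_weight w2
    obtain ⟨c, hc⟩ := t.exists_smul_e_of_weight (x := ⁅e, x₀⁆)
      (by rw [leibniz_lie, w0, lie_zero, add_zero, t.lie_h_e', smul_lie])
    have hx₀ : x₀ ∈ p := by
      have : x₀ = x₀ + x₁ + d • e - x₁ - d • e := by abel
      rw [this]
      exact p.sub_mem (p.sub_mem hx (hbp (h1 x₁ w1))) (p.smul_mem _ (hbp he))
    -- Since [e,x₀] = ce and [e,h] = -2e, adding (c/2)h moves x₀ into the centraliser of `e`.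
    refine ⟨-c / 2, d, x₀ + (c / 2) • h, x₁, ⟨?_, ?_, ?_⟩, w1, by module⟩
    · rw [lie_add, w0, lie_smul, lie_self]; simp
    · rw [lie_add, hc, lie_smul, ← lie_skew, t.lie_h_e']; module
    · exact p.add_mem hx₀ (p.smul_mem _ (hbp hh))
  refine ⟨t, hbp hh, hbp he, fun v hv => hbp (h1 v hv), hdec', fun n n0 n2 hn => hbp ?_⟩
  -- Such an `n` kills every component of `x` except the one in g(1), and g(1) is n-stable and
  -- contained in `b`.
  refine hb.mem_of_normalizes fun x hx => h1 _ ?_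
  obtain ⟨a, d, y, v, ⟨y0, y2, yp⟩, hv, rfl⟩ := hdec' x (hbp hx)
  have e1 : ⁅n, h⁆ = 0 := by rw [← lie_skew, n0, neg_zero]
  have e2 : ⁅n, e⁆ = 0 := by rw [← lie_skew, n2, neg_zero]
  simp only [lie_add, lie_smul, e1, e2, hn y y0 y2 yp, smul_zero, zero_add, add_zero]
  rw [leibniz_lie, n0, zero_lie, zero_add, hv, lie_smul]

namespace IsAdapted

variable {h e f : L} {p : LieSubalgebra ℂ L} (A : IsAdapted h e f p)
include A

/-- On a form vanishing on the vectors of weight one, but not on `e`, the stabiliser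
can be computed in the reduced subalgebra. -/
theorem formStabilizer_eq [FiniteDimensional ℂ L] [LieAlgebra.IsSimple ℂ L]
    {Γ : Module.Dual ℂ L} (he : Γ e ≠ 0)
    (h1 : ∀ v : L, ⁅h, v⁆ = (1 : ℂ) • v → Γ v = 0) :
    formStabilizer p Γ = formStabilizer (elemCentralizer h ⊓ elemCentralizer e ⊓ p) Γ := by
  have t := A.triple
  have heh : ⁅e, h⁆ = (-2 : ℂ) • e := by rw [← lie_skew, t.lie_h_e', neg_smul]
  ext x
  rw [mem_formStabilizer, mem_formStabilizer, mem_reducedSubalgebra]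
  constructor
  · rintro ⟨hx, hΓ⟩
    obtain ⟨a, d, y, v, ⟨y0, y2, yp⟩, hv, rfl⟩ := A.decomposition x hx
    have hve : ⁅v, e⁆ = 0 := by rw [← lie_skew, t.lie_e_eq_zero_of_weight hv, neg_zero]
    have hye : ⁅y, e⁆ = 0 := by rw [← lie_skew, y2, neg_zero]
    have hyh : ⁅y, h⁆ = 0 := by rw [← lie_skew, y0, neg_zero]
    -- Pairing with `e`, with g(1) and with `h` successively removes the `h`-, g(1)- and
    -- `e`-components.
    have ha : a = 0 := by
      have := hΓ e A.e_mem
      simp only [add_lie, smul_lie, hve, hye, t.lie_h_e', lie_self, smul_zero, add_zero, map_smul,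
        smul_eq_mul] at this
      simpa [he] using this
    subst ha
    have hv0 : v = 0 := by
      refine t.eq_zero_of_weight_one hv fun w hw => ?_
      obtain ⟨r, hr⟩ := t.exists_lie_eq_smul_e hv hw
      have hyw : ⁅h, ⁅y, w⁆⁆ = (1 : ℂ) • ⁅y, w⁆ := by
        rw [leibniz_lie, y0, zero_lie, zero_add, hw, lie_smul]
      have := hΓ w (A.one_mem w hw)
      simp only [add_lie, smul_lie, t.lie_e_eq_zero_of_weight hw, hr, zero_smul, smul_zero,
        add_zero, zero_add, map_add, map_smul, h1 _ hyw, smul_eq_mul] at this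
      rw [hr, (mul_eq_zero.mp this).resolve_right he, zero_smul]
    subst hv0
    have hd : d = 0 := by
      have := hΓ h A.h_mem
      simp only [add_lie, smul_lie, hyh, heh, zero_smul, zero_add, add_zero, map_smul,
        smul_eq_mul] at this
      simpa [he] using this
    subst hd
    simp only [zero_smul, zero_add, add_zero] at hΓ ⊢
    exact ⟨⟨y0, y2, yp⟩, fun z hz => hΓ z hz.2⟩
  · rintro ⟨⟨x0, x2, xp⟩, hΓ⟩
    refine ⟨xp, fun z hz => ?_⟩
    obtain ⟨a, d, y, v, hy, hv, rfl⟩ := A.decomposition z hz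
    have e1 : ⁅x, h⁆ = 0 := by rw [← lie_skew, x0, neg_zero]
    have e2 : ⁅x, e⁆ = 0 := by rw [← lie_skew, x2, neg_zero]
    have hxv : ⁅h, ⁅x, v⁆⁆ = (1 : ℂ) • ⁅x, v⁆ := by
      rw [leibniz_lie, x0, zero_lie, zero_add, hv, lie_smul]
    simp only [lie_add, lie_smul, e1, e2, smul_zero, zero_add, add_zero, map_add, h1 _ hxv]
    exact hΓ y (mem_reducedSubalgebra.mpr hy)

theorem eq_zero_of_centralizes [FiniteDimensional ℂ L] [LieAlgebra.IsSimple ℂ L] {x : L}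
    (hx : ∀ y ∈ p, ⁅x, y⁆ = 0) : x = 0 := by
  have hx' : ∀ y ∈ p, ⁅y, x⁆ = 0 := fun y hy => by rw [← lie_skew, hx y hy, neg_zero]
  exact A.triple.eq_zero_of_centralizes (hx' h A.h_mem) (hx' e A.e_mem)
    fun v hv => hx' v (A.one_mem v hv)

theorem center_eq_zero [FiniteDimensional ℂ L] [LieAlgebra.IsSimple ℂ L] {z : p}
    (hz : z ∈ LieAlgebra.center ℂ p) : (z : L) = 0 := by
  refine A.eq_zero_of_centralizes fun y hy => ?_
  have := congrArg Subtype.val (mem_center_iff'.mp hz ⟨y, hy⟩)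
  rw [← lie_skew, neg_eq_zero]
  exact this

/-- The action on `p` is faithful, so the stabiliser can replace its image in `gl(p)`. -/
theorem isReductiveType_iff [FiniteDimensional ℂ L] [LieAlgebra.IsSimple ℂ L]
    {s : LieSubalgebra ℂ L} {Γ : Module.Dual ℂ L} (hs : s = formStabilizer p Γ) (hsp : s ≤ p) :
    IsReductiveType (restrictForm p Γ) ↔ LieAlgebra.HasCentralRadical ℂ s ∧
      ∀ z ∈ LieAlgebra.center ℂ s, (adOn hsp z).IsSemisimple := by
  have hinj : ∀ x, adOn hsp x = 0 → x = 0 := fun x hx => Subtype.ext <|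
    A.eq_zero_of_centralizes fun y hy =>
      congrArg Subtype.val (LinearMap.congr_fun hx ⟨y, hy⟩)
  rw [isReductiveType_restrictForm_iff hs hsp]
  constructor
  · exact fun hr => hr.of_range _ fun x y => hinj _
  · exact fun hr => isReductiveLinear_range _ hr.1 hr.2 fun x hx => by
      rw [hinj x hx]; exact zero_mem _

/-- If Γ(e) = 0, then ℂe, an ideal of `p`, lies in the stabiliser as an abelian ideal and hence in
its centre. So `ad e` would be semisimple on `p` as well as nilpotent, contradicting [h,e] = 2e. -/
theorem apply_e_ne_zero [FiniteDimensional ℂ L] [LieAlgebra.IsSimple ℂ L]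
    {Γ : Module.Dual ℂ L} (hΓ : IsReductiveType (restrictForm p Γ)) : Γ e ≠ 0 := by
  intro he
  have t := A.triple
  obtain ⟨hr, hss⟩ := (A.isReductiveType_iff rfl (formStabilizer_le p Γ)).mp hΓ
  have hep : ∀ x ∈ p, ∃ c : ℂ, ⁅x, e⁆ = c • e := by
    intro x hx
    obtain ⟨a, d, y, v, ⟨y0, y2, yp⟩, hv, rfl⟩ := A.decomposition x hx
    refine ⟨2 * a, ?_⟩
    have hve : ⁅v, e⁆ = 0 := by rw [← lie_skew, t.lie_e_eq_zero_of_weight hv, neg_zero]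
    have hye : ⁅y, e⁆ = 0 := by rw [← lie_skew, y2, neg_zero]
    simp only [add_lie, smul_lie, hve, hye, t.lie_h_e', lie_self]
    module
  set s := formStabilizer p Γ
  have hes : e ∈ s := by
    refine mem_formStabilizer.mpr ⟨A.e_mem, fun y hy => ?_⟩
    obtain ⟨c, hc⟩ := hep y hy
    rw [← lie_skew, hc]; simp [he]
  let J : LieIdeal ℂ s :=
    { (ℂ ∙ e).comap s.toSubmodule.subtype with
      lie_mem := by
        rintro ⟨x, hx⟩ ⟨y, hy⟩ hy'
        obtain ⟨r, rfl⟩ := Submodule.mem_span_singleton.mp hy'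
        obtain ⟨c, hc⟩ := hep x (formStabilizer_le p Γ hx)
        refine Submodule.mem_span_singleton.mpr ⟨r * c, ?_⟩
        change _ = ⁅x, r • e⁆
        rw [lie_smul, hc, smul_smul] }
  have hJ : ∀ x : s, x ∈ J → ∃ r : ℂ, r • e = x := fun x hx => Submodule.mem_span_singleton.mp hx
  have hab : IsLieAbelian J := ⟨by
    rintro ⟨x, hx⟩ ⟨y, hy⟩
    obtain ⟨r, hr⟩ := hJ x hx
    obtain ⟨r', hr'⟩ := hJ y hy
    refine Subtype.ext (Subtype.ext ?_)
    change ⁅(x : L), (y : L)⁆ = 0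
    rw [← hr, ← hr']; simp⟩
  have hJc : J ≤ LieAlgebra.center ℂ s := by
    rw [← hr.radical_eq_center]
    exact (LieAlgebra.LieIdeal.solvable_iff_le_radical ℂ s J).mp inferInstance
  have hss' := hss ⟨e, hes⟩ (hJc (Submodule.mem_span_singleton_self e))
  have h0 := Module.End.eq_zero_of_isNilpotent_isSemisimple ⟨3, by
    ext y
    exact t.lie_e_lie_e_lie_e (y : L)⟩ hss'
  have h2 : ⁅e, h⁆ = 0 := congrArg Subtype.val (LinearMap.congr_fun h0 ⟨h, A.h_mem⟩)
  rw [← lie_skew, t.lie_h_e', neg_eq_zero] at h2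
  exact t.e_ne_zero ((smul_eq_zero.mp h2).resolve_left two_ne_zero)

/-- Passing from `p` to the reduced subalgebra. -/
theorem reduce [FiniteDimensional ℂ L] [LieAlgebra.IsSimple ℂ L]
    {Γ : Module.Dual ℂ L} (hΓ : IsReductiveType (restrictForm p Γ))
    (h1 : ∀ v : L, ⁅h, v⁆ = (1 : ℂ) • v → Γ v = 0) :
    IsReductiveType (restrictForm (elemCentralizer h ⊓ elemCentralizer e ⊓ p) Γ) ∧
      IsStronglyQuasiReductive (elemCentralizer h ⊓ elemCentralizer e ⊓ p) := by
  have hs := A.formStabilizer_eq (A.apply_e_ne_zero hΓ) h1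
  set q := elemCentralizer h ⊓ elemCentralizer e ⊓ p with hq
  have hqp : q ≤ p := inf_le_right
  obtain ⟨hr, hss⟩ := (A.isReductiveType_iff rfl (formStabilizer_le p Γ)).mp hΓ
  have hsq : formStabilizer p Γ ≤ q := hs ▸ formStabilizer_le q Γ
  -- The centre of `q` lies in the stabiliser of every form on `q`, and is central there.
  have hcomm : ∀ z ∈ q, (∀ y ∈ q, ⁅z, y⁆ = 0) →
      ∃ hz : z ∈ formStabilizer p Γ, ⟨z, hz⟩ ∈ LieAlgebra.center ℂ (formStabilizer p Γ) := by
    intro z hz hzc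
    have hzs : z ∈ formStabilizer p Γ := by
      rw [hs]
      exact mem_formStabilizer.mpr ⟨hz, fun y hy => by rw [hzc y hy, map_zero]⟩
    refine ⟨hzs, mem_center_iff'.mpr fun x => Subtype.ext ?_⟩
    change ⁅(x : L), z⁆ = 0
    rw [← lie_skew, hzc x (hsq x.2), neg_zero]
  have hred : IsReductiveType (restrictForm q Γ) := by
    rw [isReductiveType_restrictForm_iff hs hsq]
    refine isReductiveLinear_range _ hr (fun z hz => ?_) fun z hz => ?_
    · exact isSemisimple_ad_of_le hqp (hsq z.2) (hss z hz)
    · exact (hcomm z (hsq z.2) fun y hy =>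
        congrArg Subtype.val (LinearMap.congr_fun hz ⟨y, hy⟩)).2
  refine ⟨hred, ⟨_, hred⟩, fun z hz => ?_⟩
  obtain ⟨hzs, hzc⟩ := hcomm z z.2 fun y hy => by
    have := congrArg Subtype.val (mem_center_iff'.mp hz ⟨y, hy⟩)
    rw [← lie_skew, neg_eq_zero]
    exact this
  obtain ⟨n, hn, hzn, hna⟩ := exists_jordan_decomposition (z : L)
  have hn0 : n = 0 := A.eq_zero_of_centralizes
    (lie_eq_zero_of_isSemisimple_ad (hqp z.2) (hss _ hzc) hn hna)
  rwa [hn0, sub_zero] at hzn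

/-- Passing from the reduced subalgebra to `p`. -/
theorem lift [FiniteDimensional ℂ L] [LieAlgebra.IsSimple ℂ L]
    {Γ : Module.Dual ℂ L} (he : Γ e ≠ 0)
    (h1 : ∀ v : L, ⁅h, v⁆ = (1 : ℂ) • v → Γ v = 0)
    (hΓ : IsReductiveType (restrictForm (elemCentralizer h ⊓ elemCentralizer e ⊓ p) Γ))
    (hq : IsStronglyQuasiReductive (elemCentralizer h ⊓ elemCentralizer e ⊓ p)) :
    IsReductiveType (restrictForm p Γ) := by
  have hs := A.formStabilizer_eq he h1
  set q := elemCentralizer h ⊓ elemCentralizer e ⊓ p with hqdef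
  have hqp : q ≤ p := inf_le_right
  have hqc : ∀ z ∈ q, (∀ y ∈ q, ⁅z, y⁆ = 0) → IsSemisimpleElem z := by
    intro z hz hzc
    refine hq.2 ⟨z, hz⟩ (mem_center_iff'.mpr fun x => Subtype.ext ?_)
    change ⁅(x : L), z⁆ = 0
    rw [← lie_skew, hzc x x.2, neg_zero]
  have hzero : ∀ z : L, IsSemisimpleElem z → IsNilpotentElem z → z = 0 := by
    intro z hz hn
    have h0 := Module.End.eq_zero_of_isNilpotent_isSemisimple hn hz
    exact A.eq_zero_of_centralizes fun y _ => LinearMap.congr_fun h0 y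
  have hsq : formStabilizer p Γ ≤ q := hs ▸ formStabilizer_le q Γ
  rw [isReductiveType_restrictForm_iff hs hsq] at hΓ
  -- A commutator acting trivially on `q` is central in `q`, hence semisimple. Since it commutes
  -- with both of its factors it is also nilpotent, so it vanishes.
  obtain ⟨hr, hss⟩ := hΓ.of_range _ (by
    rintro ⟨x, hx⟩ ⟨y, hy⟩ hxy
    have hzc : ∀ w ∈ q, ⁅⁅x, y⁆, w⁆ = 0 := fun w hw =>
      congrArg Subtype.val (LinearMap.congr_fun hxy ⟨w, hw⟩)
    have hcommute : ∀ w ∈ q, Commute (LieAlgebra.ad ℂ L w) (LieAlgebra.ad ℂ L ⁅x, y⁆) := by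
      intro w hw
      have := LieHom.map_lie (LieAlgebra.ad ℂ L) ⁅x, y⁆ w
      rw [hzc w hw, map_zero, LieRing.of_associative_ring_bracket] at this
      exact (sub_eq_zero.mp this.symm).symm
    refine Subtype.ext (hzero _ (hqc _ (q.lie_mem (hsq hx) (hsq hy)) hzc) ?_)
    refine isNilpotent_of_commutator (x := LieAlgebra.ad ℂ L x) (y := LieAlgebra.ad ℂ L y) ?_
      (hcommute x (hsq hx)) (hcommute y (hsq hy))
    rw [← LieRing.of_associative_ring_bracket, ← LieHom.map_lie]
    rfl)
  refine (A.isReductiveType_iff rfl (formStabilizer_le p Γ)).mpr ⟨hr, fun z hz => ?_⟩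
  have hzq : (z : L) ∈ q := hsq z.2
  obtain ⟨z0, z2, zp⟩ := mem_reducedSubalgebra.mp hzq
  obtain ⟨n, hn, hzn, hna⟩ := exists_jordan_decomposition (z : L)
  have hnq := lie_eq_zero_of_isSemisimple_ad hzq (hss z hz) hn hna
  have hn' : ∀ y : L, ⁅y, (z : L)⁆ = 0 → ⁅y, n⁆ = 0 := fun y hy => by
    rw [← lie_skew, lie_eq_zero_of_mem_adjoin hn hna (by rw [← lie_skew, hy, neg_zero]), neg_zero]
  -- The nilpotent part `n` centralises `q`; `mem_of_centralizes` puts it in the centre of `q`,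
  -- whose elements are semisimple, so `n = 0`.
  have hnmem : n ∈ q := mem_reducedSubalgebra.mpr ⟨hn' h z0, hn' e z2,
    A.mem_of_centralizes n (hn' h z0) (hn' e z2) fun y y0 y2 yp =>
      hnq y (mem_reducedSubalgebra.mpr ⟨y0, y2, yp⟩)⟩
  have hn0 : n = 0 := hzero n (hqc n hnmem hnq) hn
  rw [hn0, sub_zero] at hzn
  exact hzn.isSemisimple_ad (formStabilizer_le p Γ z.2)

/-! ### Normalising and extending linear forms -/

omit A in
theorem inParabolicSubgroup_of_mapsTo [FiniteDimensional ℂ L] {φ : L ≃ₗ⁅ℂ⁆ L}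
    (hφ : InAdjointGroup φ) (h : ∀ x ∈ p, φ x ∈ p) : InParabolicSubgroup p φ := by
  refine ⟨hφ, LieSubalgebra.toSubmodule_injective ?_⟩
  refine Submodule.eq_of_le_of_finrank_eq ?_ ?_
  · rintro _ ⟨x, hx, rfl⟩
    exact h x hx
  · exact LinearEquiv.finrank_map_eq φ.toLinearEquiv p.toSubmodule

/-- As Γ(e) ≠ 0, the form Γ([v,w]) on g(1) is nondegenerate, so some v satisfies Γ([v,w]) = -Γ(w)
for all w. On g(1), exp(ad v) is w ↦ w + [v,w]. -/
theorem exists_exp_normalizing [FiniteDimensional ℂ L] [LieAlgebra.IsSimple ℂ L]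
    {Γ : Module.Dual ℂ L} (he : Γ e ≠ 0) : ∃ φ : L ≃ₗ⁅ℂ⁆ L, InParabolicSubgroup p φ ∧
      ∀ v : L, ⁅h, v⁆ = (1 : ℂ) • v → Γ (φ v) = 0 := by
  have t := A.triple
  let V : Submodule ℂ L := gradedPiece h 1
  have hV : ∀ v, v ∈ V ↔ ⁅h, v⁆ = (1 : ℂ) • v := fun v => by
    rw [mem_gradedPiece_iff]; norm_num
  let B : V →ₗ[ℂ] Module.Dual ℂ V := LinearMap.mk₂ ℂ (fun v w : V => Γ ⁅(v : L), (w : L)⁆)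
    (fun a b c => by simp) (fun a b c => by simp) (fun a b c => by simp) (fun a b c => by simp)
  have hB : ∀ v w : V, B v w = Γ ⁅(v : L), (w : L)⁆ := fun v w => rfl
  have hinj : Function.Injective B := by
    rw [injective_iff_map_eq_zero]
    intro v hv
    refine Subtype.ext (t.eq_zero_of_weight_one ((hV v).mp v.2) fun w hw => ?_)
    obtain ⟨r, hr⟩ := t.exists_lie_eq_smul_e ((hV v).mp v.2) hw
    have := hB v ⟨w, (hV w).mpr hw⟩
    rw [hv, LinearMap.zero_apply, hr, map_smul, smul_eq_mul] at this
    rw [hr, (mul_eq_zero.mp this.symm).resolve_right he, zero_smul]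
  have hsurj : Function.Surjective B :=
    (LinearMap.injective_iff_surjective_of_finrank_eq_finrank
      (Subspace.dual_finrank_eq).symm).mp hinj
  obtain ⟨v, hv⟩ := hsurj (-(Γ ∘ₗ V.subtype))
  have hvw : ∀ w : L, ⁅h, w⁆ = (1 : ℂ) • w → Γ ⁅(v : L), w⁆ = - Γ w := fun w hw => by
    have := LinearMap.congr_fun hv ⟨w, (hV w).mpr hw⟩
    exact this
  have hv1 := (hV v).mp v.2
  have hve : ⁅(v : L), e⁆ = 0 := by rw [← lie_skew, t.lie_e_eq_zero_of_weight hv1, neg_zero]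
  have hvh : ⁅(v : L), h⁆ = -(v : L) := by rw [← lie_skew, hv1, one_smul]
  obtain ⟨φ, hφ, hφ'⟩ := exists_exp_ad_quadratic
    (isNilpotent_ad_of_lie_eq_smul one_ne_zero hv1 : IsNilpotentElem (v : L)) 1
  have hvp : (v : L) ∈ p := A.one_mem v hv1
  refine ⟨φ, inParabolicSubgroup_of_mapsTo hφ fun x hx => ?_, fun w hw => ?_⟩
  · rw [hφ']
    · have h2 := p.lie_mem hvp hx
      exact p.add_mem (p.add_mem hx (p.smul_mem _ h2)) (p.smul_mem _ (p.lie_mem hvp h2))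
    · obtain ⟨a, d, y, w, ⟨y0, -, -⟩, hw, rfl⟩ := A.decomposition x hx
      obtain ⟨r, hr⟩ := t.exists_lie_eq_smul_e hv1 hw
      obtain ⟨r', hr'⟩ := t.exists_lie_eq_smul_e (y := ⁅(v : L), y⁆) hv1
        (by rw [leibniz_lie, y0, lie_zero, add_zero, hv1, smul_lie])
      simp only [lie_add, lie_smul, hve, hvh, hr, hr', lie_neg, lie_self, lie_zero, smul_zero,
        neg_zero, add_zero]
  · obtain ⟨r, hr⟩ := t.exists_lie_eq_smul_e hv1 hw
    rw [hφ' w (by simp [hr, hve])]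
    have h2 : ⁅(v : L), ⁅(v : L), w⁆⁆ = 0 := by rw [hr, lie_smul, hve, smul_zero]
    rw [h2, smul_zero, add_zero, one_smul, map_add, hvw w hw, add_neg_cancel]

/-- Take Γ on the degree 0 part and add the Killing form against `f`, which sees only g(2) and is
nonzero at `e` by nondegeneracy. -/
theorem exists_extension [FiniteDimensional ℂ L] [LieAlgebra.IsSimple ℂ L]
    (Γ : Module.Dual ℂ L) : ∃ Γ' : Module.Dual ℂ L, Γ' e ≠ 0 ∧
      (∀ v : L, ⁅h, v⁆ = (1 : ℂ) • v → Γ' v = 0) ∧ ∀ y : L, ⁅h, y⁆ = 0 → Γ' y = Γ y := by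
  have t := A.triple
  have hff := t.lie_h_f'
  have hκ0 : ∀ y : L, ⁅h, y⁆ = 0 → killingForm ℂ L f y = 0 := fun y hy =>
    IsExtremalTriple.killingForm_eq_zero_of_weight (b := 0) hff (by rw [hy, zero_smul])
      (by norm_num)
  have hκ1 : ∀ y : L, ⁅h, y⁆ = (1 : ℂ) • y → killingForm ℂ L f y = 0 := fun y hy =>
    IsExtremalTriple.killingForm_eq_zero_of_weight hff hy (by norm_num)
  have hκe : killingForm ℂ L f e ≠ 0 := by
    intro hfe
    have h0 : killingForm ℂ L f = 0 := by
      ext y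
      obtain ⟨a, b, c, d, k, ha, hb, hc, hd, hk, rfl⟩ := t.exists_decomposition y
      obtain ⟨r, rfl⟩ := t.exists_smul_e_of_weight hk
      simp only [map_add, map_smul, hfe, hκ1 d hd, hκ0 c (by rw [hc, zero_smul]),
        IsExtremalTriple.killingForm_eq_zero_of_weight hff ha (by norm_num),
        IsExtremalTriple.killingForm_eq_zero_of_weight hff hb (by norm_num), smul_zero, add_zero,
        LinearMap.zero_apply]
    have h1 : f ∈ LinearMap.ker (killingForm ℂ L) := h0
    exact t.f_ne_zero (by simpa using h1)
  let H := LieAlgebra.ad ℂ L h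
  -- The polynomial (c²-1)(c²-4)/4 is 1 at 0 and 0 at ±1, ±2, so this projects onto g(0).
  let π : L →ₗ[ℂ] L := (1 / 4 : ℂ) • (H ∘ₗ H ∘ₗ H ∘ₗ H - (5 : ℂ) • H ∘ₗ H + (4 : ℂ) • LinearMap.id)
  have hπ : ∀ (x : L) (c : ℂ), ⁅h, x⁆ = c • x → π x = ((1 / 4) * (c ^ 4 - 5 * c ^ 2 + 4)) • x := by
    intro x c hx
    simp only [π, H, LinearMap.smul_apply, LinearMap.add_apply, LinearMap.sub_apply,
      LinearMap.comp_apply, LinearMap.id_apply, LieAlgebra.ad_apply, hx, lie_smul]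
    module
  refine ⟨Γ ∘ₗ π + killingForm ℂ L f, ?_, fun v hv => ?_, fun y hy => ?_⟩
  · rw [LinearMap.add_apply, LinearMap.comp_apply, hπ e 2 t.lie_h_e']
    norm_num [hκe]
  · rw [LinearMap.add_apply, LinearMap.comp_apply, hπ v 1 hv, hκ1 v hv]
    norm_num
  · rw [LinearMap.add_apply, LinearMap.comp_apply, hπ y 0 (by rw [hy, zero_smul]), hκ0 y hy]
    norm_num

theorem isStronglyQuasiReductive [FiniteDimensional ℂ L] [LieAlgebra.IsSimple ℂ L]
    {Γ : Module.Dual ℂ L} (hΓ : IsReductiveType (restrictForm p Γ)) :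
    IsStronglyQuasiReductive p := by
  refine ⟨⟨_, hΓ⟩, fun x hx => ?_⟩
  rw [A.center_eq_zero hx]
  unfold IsSemisimpleElem
  rw [map_zero]
  exact Module.End.isSemisimple_zero

/-! ### Comparison of the maximal reductive stabilisers -/

theorem exists_reduction [FiniteDimensional ℂ L] [LieAlgebra.IsSimple ℂ L]
    {Γ : Module.Dual ℂ L} (hΓ : IsReductiveType (restrictForm p Γ)) :
    IsStronglyQuasiReductive (elemCentralizer h ⊓ elemCentralizer e ⊓ p) ∧
      ∃ φ : L ≃ₗ⁅ℂ⁆ L, InParabolicSubgroup p φ ∧ ∃ Γ' : Module.Dual ℂ L,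
        (∀ x, Γ' x = Γ (φ x)) ∧
        IsReductiveType (restrictForm (elemCentralizer h ⊓ elemCentralizer e ⊓ p) Γ') ∧
        (formStabilizer (elemCentralizer h ⊓ elemCentralizer e ⊓ p) Γ').map φ.toLieHom =
          formStabilizer p Γ := by
  obtain ⟨φ, hφ, h1⟩ := A.exists_exp_normalizing (A.apply_e_ne_zero hΓ)
  have hΓ' := isReductiveType_comp hφ.2 hΓ
  obtain ⟨hr, hq⟩ := A.reduce hΓ' h1
  refine ⟨hq, φ, hφ, _, fun x => rfl, hr, ?_⟩
  rw [← A.formStabilizer_eq (A.apply_e_ne_zero hΓ') h1]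
  exact map_formStabilizer_comp hφ.2 Γ

theorem exists_lift [FiniteDimensional ℂ L] [LieAlgebra.IsSimple ℂ L] {Γ : Module.Dual ℂ L}
    (hq : IsStronglyQuasiReductive (elemCentralizer h ⊓ elemCentralizer e ⊓ p))
    (hΓ : IsReductiveType (restrictForm (elemCentralizer h ⊓ elemCentralizer e ⊓ p) Γ)) :
    ∃ Γ' : Module.Dual ℂ L, IsReductiveType (restrictForm p Γ') ∧
      (∀ x ∈ elemCentralizer h ⊓ elemCentralizer e ⊓ p, Γ' x = Γ x) ∧
      formStabilizer (elemCentralizer h ⊓ elemCentralizer e ⊓ p) Γ = formStabilizer p Γ' := by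
  obtain ⟨Γ', he, h1, h0⟩ := A.exists_extension Γ
  have hagree : ∀ x ∈ elemCentralizer h ⊓ elemCentralizer e ⊓ p, Γ' x = Γ x :=
    fun x hx => h0 x (mem_reducedSubalgebra.mp hx).1
  have hres : restrictForm (elemCentralizer h ⊓ elemCentralizer e ⊓ p) Γ =
      restrictForm (elemCentralizer h ⊓ elemCentralizer e ⊓ p) Γ' := by
    ext x; exact (hagree x x.2).symm
  refine ⟨Γ', A.lift he h1 (hres ▸ hΓ) hq, hagree, ?_⟩
  rw [A.formStabilizer_eq he h1, formStabilizer, formStabilizer, hres]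

theorem mem_MStar_iff_exists_map [FiniteDimensional ℂ L] [LieAlgebra.IsSimple ℂ L]
    (r : LieSubalgebra ℂ L) : r ∈ MStar p ↔
      ∃ r' ∈ MStar (elemCentralizer h ⊓ elemCentralizer e ⊓ p),
        ∃ φ : L ≃ₗ⁅ℂ⁆ L, InParabolicSubgroup p φ ∧ r = r'.map φ.toLieHom := by
  constructor
  · intro hr
    obtain ⟨-, Γ, hΓ, hn, rfl⟩ := mem_MStar_iff.mp hr
    obtain ⟨hq, φ, hφ, Γ', hΓφ, hΓ', hmap⟩ := A.exists_reduction hΓ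
    refine ⟨_, mem_MStar_iff.mpr ⟨hq, Γ', hΓ', fun x hx => ?_, rfl⟩, φ, hφ, hmap.symm⟩
    rw [hΓφ]
    refine hn _ ?_
    rw [← hmap]
    exact ⟨x, hx, rfl⟩
  · rintro ⟨r', hr', φ, hφ, rfl⟩
    obtain ⟨hq, Γ, hΓ, hn, rfl⟩ := mem_MStar_iff.mp hr'
    obtain ⟨Γ', hΓ', hagree, hs⟩ := A.exists_lift hq hΓ
    have hΓ'' := isReductiveType_comp hφ.symm.2 hΓ'
    set Γ'' : Module.Dual ℂ L := Γ' ∘ₗ (φ.symm.toLinearEquiv : L →ₗ[ℂ] L)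
    have hcomp : Γ'' ∘ₗ (φ.toLinearEquiv : L →ₗ[ℂ] L) = Γ' := by
      ext x; exact congrArg Γ' (LieEquiv.symm_apply_apply φ x)
    have hmap : (formStabilizer (elemCentralizer h ⊓ elemCentralizer e ⊓ p) Γ).map φ.toLieHom =
        formStabilizer p Γ'' := by
      rw [hs, ← map_formStabilizer_comp hφ.2 Γ'', hcomp]
    refine mem_MStar_iff.mpr ⟨A.isStronglyQuasiReductive hΓ'', Γ'', hΓ'', ?_, hmap⟩
    rw [← hmap]
    rintro _ ⟨x, hx, rfl⟩
    refine (LinearMap.congr_fun hcomp x).trans ?_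
    rw [hagree x (formStabilizer_le _ _ hx)]
    exact hn x hx

end IsAdapted

end HighestRootReduction

open HighestRootReduction in
theorem proposition4p7 {L : Type*} [LieRing L] [LieAlgebra ℂ L] [FiniteDimensional ℂ L]
    [LieAlgebra.IsSimple ℂ L]
    (e h f : L) (he : IsMinimalNilpotent e) (ht : IsSl2Triple h e f)
    (p : LieSubalgebra ℂ L) (hp : IsParabolic p)
    (hpe : p.toSubmodule ≤ gradedPiece h 0 ⊔ gradedPiece h 1 ⊔ gradedPiece h 2) :
    (IsStronglyQuasiReductive p ↔
      IsStronglyQuasiReductive (elemCentralizer h ⊓ elemCentralizer e ⊓ p)) ∧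
    (∀ r : LieSubalgebra ℂ L, r ∈ MStar p ↔
      ∃ r' ∈ MStar (elemCentralizer h ⊓ elemCentralizer e ⊓ p),
        ∃ φ : L ≃ₗ⁅ℂ⁆ L, InParabolicSubgroup p φ ∧ r = r'.map φ.toLieHom) ∧
    (∀ r ∈ MStar p, ∃ φ : L ≃ₗ⁅ℂ⁆ L, InParabolicSubgroup p φ ∧
      r.map φ.toLieHom ∈ MStar p ∧
      r.map φ.toLieHom ≤ elemCentralizer h ⊓ elemCentralizer e ⊓ p) := by
  have A : IsAdapted h e f p := hp.isAdapted ⟨ht, he.extremal ht⟩ hpe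
  refine ⟨⟨?_, ?_⟩, A.mem_MStar_iff_exists_map, fun r hr => ?_⟩
  · rintro ⟨⟨γ, hγ⟩, -⟩
    obtain ⟨Γ, rfl⟩ := exists_restrictForm_eq γ
    exact (A.exists_reduction hγ).1
  · intro hq
    obtain ⟨γ, hγ⟩ := hq.1
    obtain ⟨Γ, rfl⟩ := exists_restrictForm_eq γ
    obtain ⟨Γ', hΓ', -, -⟩ := A.exists_lift hq hγ
    exact A.isStronglyQuasiReductive hΓ'
  · obtain ⟨r', hr', φ, hφ, rfl⟩ := (A.mem_MStar_iff_exists_map r).mp hr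
    have hback : (r'.map φ.toLieHom).map φ.symm.toLieHom = r' := by
      ext x
      constructor
      · rintro ⟨_, ⟨y, hy, rfl⟩, rfl⟩
        have : φ.symm (φ y) = y := LieEquiv.symm_apply_apply φ y
        change φ.symm (φ y) ∈ r'
        rwa [this]
      · intro hx
        exact ⟨φ x, ⟨x, hx, rfl⟩, LieEquiv.symm_apply_apply φ x⟩
    -- Undoing the conjugation returns r', which represents M_*(p) by the second statement with the
    -- identity automorphism.
    refine ⟨φ.symm, hφ.symm, ?_, ?_⟩
    · rw [hback]
      refine (A.mem_MStar_iff_exists_map r').mpr ⟨r', hr', LieEquiv.refl, ⟨.refl, ?_⟩, ?_⟩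
      · ext x; exact ⟨by rintro ⟨y, hy, rfl⟩; exact hy, fun hx => ⟨x, hx, rfl⟩⟩
      · ext x; exact ⟨fun hx => ⟨x, hx, rfl⟩, by rintro ⟨y, hy, rfl⟩; exact hy⟩
    · rw [hback]
      obtain ⟨-, Γ, -, -, rfl⟩ := mem_MStar_iff.mp hr'
      exact formStabilizer_le _ _
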